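/- Let $L,\rho_1,\rho_2,k,b,\gamma>0$, and let $H^1_*(0,L)=\{w\in H^1(0,L): w(0)=0\}$ (real functions). Let $\mathcal H=[H^1_*(0,L)\times L^2(0,L)]^3\times\mathbb R^3$, with elements $U=(w,\Psi_1,\xi,\Psi_2,s,\Psi_3,\Psi_4,\Psi_5,\Psi_6)$, normed by $$\|U\|_{\mathcal H}^2=3\rho_1\|\Psi_1\|^2+3\rho_2\|\Psi_2\|^2+\rho_2\|\Psi_3\|^2+3b\|\xi_x\|^2+b\|s_x\|^2+\gamma\|s\|^2+3k\|w_x+\xi+s\|^2+3k|\Psi_4|^2+3b|\Psi_5|^2+b|\Psi_6|^2 ,$$ where $\|\cdot\|$ is the norm of $L^2(0,L)$. Let $\mathcal A$ be the operator in $\mathcal H$ with domain $$D(\mathcal A)=\{U\in\mathcal H:\ w,\xi,s\in H^2(0,L)\cap H^1_*(0,L),\ \Psi_1,\Psi_2,\Psi_3\in H^1_*(0,L),\ \Psi_4=\Psi_1(L),\ \Psi_5=\Psi_2(L),\ \Psi_6=\Psi_3(L)\}$$ (equipped with the graph norm) and $$\mathcal AU=\Big(\Psi_1,\ \tfrac{k}{\rho_1}(w_x+\xi+s)_x,\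 \Psi_2,\ \tfrac1{\rho_2}[b\xi_{xx}-k(w_x+\xi+s)],\ \Psi_3,\ \tfrac1{\rho_2}[bs_{xx}-3k(w_x+\xi+s)-\gamma s],\ -(w_x(L)+\xi(L)+s(L)),\ -\xi_x(L),\ -s_x(L)\Big).$$ **Theorem.** Let $U_0=(w_0,w_1,\xi_0,\xi_1,s_0,s_1,w_1(L),\xi_1(L),s_1(L))\in D(\mathcal A)$ and let $u_1,u_2,u_3\in C_0^\infty(0,\infty)$ (smooth, with compact support in $(0,\infty)$). Then the system $$\begin{cases} \rho_1w_{tt}-k(w_x+\xi+s)_x=0, & x\in(0,L),\ t>0,\\ \rho_2\xi_{tt}-b\xi_{xx}+k(w_x+\xi+s)=0, & x\in(0,L),\ t>0,\\ \rho_2s_{tt}-bs_{xx}+3k(w_x+\xi+s)+\gamma s=0, & x\in(0,L),\ t>0,\\ w(0,t)=\xi(0,t)=s(0,t)=0, & t>0,\\ w_{tt}(L,t)+w_x(L,t)+\xi(L,t)+s(L,t)=u_1(t), & t>0,\\ \xi_{tt}(L,t)+\xi_x(L,t)=u_2(t), & t>0,\\ s_{tt}(L,t)+s_x(L,t)=u_3(t),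 & t>0,\\ (w,\xi,s)(x,0)=(w_0,\xi_0,s_0)(x),\quad (w_t,\xi_t,s_t)(x,0)=(w_1,\xi_1,s_1)(x), & x\in(0,L), \end{cases}$$ has a unique solution $U=(w,w_t,\xi,\xi_t,s,s_t,w_t(L,\cdot),\xi_t(L,\cdot),s_t(L,\cdot))$ in $C([0,\infty);D(\mathcal A))\cap C^1([0,\infty);\mathcal H)$. Here time derivatives of $w,\xi,s,w_t,\xi_t,s_t$ are those of $L^2(0,L)$-valued curves, $w_{tt}(L,t)$ means $\frac{d}{dt}\big[w_t(L,t)\big]$ (likewise for $\xi$ and $s$), and the three equations hold in $L^2(0,L)$ for every $t>0$. -/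

import Mathlib

open MeasureTheory Set Filter Topology
open scoped ContDiff

noncomputable section

namespace LaminatedBeam

/-- The Lebesgue space `L²(0, L)` of real functions. -/
abbrev L2 (L : ℝ) : Type := Lp ℝ 2 (volume.restrict (Ioo 0 L))

/-- `φ ∈ C_c^∞(I)` for an open set `I ⊆ ℝ`. -/
structure IsTestFunction (I : Set ℝ) (φ : ℝ → ℝ) : Prop where
  contDiff : ContDiff ℝ ∞ φ
  hasCompactSupport : HasCompactSupport φ
  tsupport_subset : tsupport φ ⊆ I

/-- `g` is the weak derivative of `f` on `(0, L)`. -/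
def IsWeakDeriv {L : ℝ} (f g : L2 L) : Prop :=
  ∀ φ : ℝ → ℝ, IsTestFunction (Ioo 0 L) φ →
    ∫ x in Ioo 0 L, f x * deriv φ x = -∫ x in Ioo 0 L, g x * φ x

/-- `f` has a representative that is continuous on `[0, L]` and takes the value `c` at `a`. -/
def HasTrace {L : ℝ} (f : L2 L) (a c : ℝ) : Prop :=
  ∃ F : ℝ → ℝ, ContinuousOn F (Icc 0 L) ∧ f =ᵐ[volume.restrict (Ioo 0 L)] F ∧ F a = c

section Calculus

variable {L : ℝ}

theorem L2.integrable (f : L2 L) : Integrable f (volume.restrict (Ioo 0 L)) := by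
  have : IsFiniteMeasure (volume.restrict (Ioo 0 L)) := ⟨by simp⟩
  exact (Lp.memLp f).integrable (by norm_num)

theorem IsTestFunction.integrable_mul {φ : ℝ → ℝ} (hφ : Continuous φ) (hc : HasCompactSupport φ)
    {f : ℝ → ℝ} (hf : Integrable f (volume.restrict (Ioo 0 L))) :
    Integrable (fun x => f x * φ x) (volume.restrict (Ioo 0 L)) := by
  obtain ⟨C, hC⟩ := hφ.bounded_above_of_compact_support hc
  exact hf.mul_bdd (c := C) hφ.aestronglyMeasurable (Eventually.of_forall hC)

theorem IsTestFunction.deriv {φ : ℝ → ℝ} {I : Set ℝ} (h : IsTestFunction I φ) :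
    IsTestFunction I (deriv φ) :=
  ⟨(contDiff_infty_iff_deriv.1 h.contDiff).2, h.hasCompactSupport.deriv,
    (tsupport_deriv_subset).trans h.tsupport_subset⟩

theorem IsTestFunction.integrable {φ : ℝ → ℝ} (h : IsTestFunction (Ioo 0 L) φ)
    {f : ℝ → ℝ} (hf : Integrable f (volume.restrict (Ioo 0 L))) :
    Integrable (fun x => f x * φ x) (volume.restrict (Ioo 0 L)) :=
  IsTestFunction.integrable_mul h.contDiff.continuous h.hasCompactSupport hf

/-- The fundamental lemma of the calculus of variations on `(0, L)`. -/
theorem ae_eq_zero_of_test {f : ℝ → ℝ} (hf : Integrable f (volume.restrict (Ioo 0 L)))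
    (h : ∀ φ : ℝ → ℝ, IsTestFunction (Ioo 0 L) φ → ∫ x in Ioo 0 L, f x * φ x = 0) :
    f =ᵐ[volume.restrict (Ioo 0 L)] 0 := by
  have hf' : IntegrableOn f (Ioo 0 L) := hf
  have key := isOpen_Ioo.ae_eq_zero_of_integral_contDiff_smul_eq_zero (U := Ioo (0 : ℝ) L)
    (μ := volume) (f := f) hf'.locallyIntegrableOn (fun φ h1 h2 h3 => by
      rw [← h φ ⟨h1, h2, h3⟩, setIntegral_eq_integral_of_forall_compl_eq_zero]
      · simp [mul_comm]
      · intro x hx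
        have : φ x = 0 := image_eq_zero_of_notMem_tsupport fun hx' => hx (h3 hx')
        simp [this])
  rw [EventuallyEq, ae_restrict_iff' measurableSet_Ioo]
  simpa using key

/-- An integrable function on `(0, L)` with vanishing weak derivative is constant. -/
theorem ae_eq_const_of_test (hL : 0 < L) {f : ℝ → ℝ}
    (hf : Integrable f (volume.restrict (Ioo 0 L)))
    (h : ∀ φ : ℝ → ℝ, IsTestFunction (Ioo 0 L) φ → ∫ x in Ioo 0 L, f x * deriv φ x = 0) :
    ∃ c : ℝ, f =ᵐ[volume.restrict (Ioo 0 L)] fun _ => c := by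
  have hfin : IsFiniteMeasure (volume.restrict (Ioo 0 L)) := ⟨by simp⟩
  let B : ContDiffBump (L / 2) := ⟨L / 8, L / 4, by linarith, by linarith⟩
  let ψ₀ : ℝ → ℝ := B.normed volume
  have hψ₀ : IsTestFunction (Ioo 0 L) ψ₀ := by
    refine ⟨B.contDiff_normed, B.hasCompactSupport_normed, ?_⟩
    rw [B.tsupport_normed_eq, Real.closedBall_eq_Icc]
    intro x hx
    have h1 : L / 2 - L / 4 ≤ x := hx.1
    have h2 : x ≤ L / 2 + L / 4 := hx.2
    constructor <;> linarith
  have hint₀ : ∫ x, ψ₀ x = 1 := B.integral_normed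
  refine ⟨∫ x in Ioo 0 L, f x * ψ₀ x, ?_⟩
  set c := ∫ x in Ioo 0 L, f x * ψ₀ x with hc
  suffices (fun x => f x - c) =ᵐ[volume.restrict (Ioo 0 L)] 0 by
    filter_upwards [this] with x hx
    exact sub_eq_zero.1 hx
  refine ae_eq_zero_of_test (hf.sub (integrable_const c)) fun ψ hψ => ?_
  set m := ∫ x, ψ x with hm
  let θ : ℝ → ℝ := fun x => ψ x - m * ψ₀ x
  have hθc : ContDiff ℝ ∞ θ := hψ.contDiff.sub (contDiff_const.mul hψ₀.contDiff)
  have hψi : Integrable ψ := hψ.contDiff.continuous.integrable_of_hasCompactSupport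
    hψ.hasCompactSupport
  have hψ₀i : Integrable ψ₀ := hψ₀.contDiff.continuous.integrable_of_hasCompactSupport
    hψ₀.hasCompactSupport
  have hθi : Integrable θ := hψi.sub (hψ₀i.const_mul m)
  have hθ0 : ∫ x, θ x = 0 := by
    rw [integral_sub hψi (hψ₀i.const_mul m), integral_const_mul, hint₀]; simp [hm]
  let K := tsupport ψ ∪ tsupport ψ₀
  have hK : IsCompact K := hψ.hasCompactSupport.isCompact.union hψ₀.hasCompactSupport.isCompact
  have hKI : K ⊆ Ioo 0 L := union_subset hψ.tsupport_subset hψ₀.tsupport_subset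
  have hKne : K.Nonempty := by
    refine ⟨L / 2, Or.inr ?_⟩
    rw [B.tsupport_normed_eq]
    exact Metric.mem_closedBall_self (by simp [B]; linarith)
  have hθK : ∀ x, x ∉ K → θ x = 0 := fun x hx => by
    have h1 : ψ x = 0 := image_eq_zero_of_notMem_tsupport fun h => hx (Or.inl h)
    have h2 : ψ₀ x = 0 := image_eq_zero_of_notMem_tsupport fun h => hx (Or.inr h)
    simp [θ, h1, h2]
  obtain ⟨a, haK, ha⟩ := hK.exists_isLeast hKne
  obtain ⟨b, hbK, hb⟩ := hK.exists_isGreatest hKne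
  let φ : ℝ → ℝ := fun x => ∫ t in (0 : ℝ)..x, θ t
  have hφd : ∀ x, HasDerivAt φ (θ x) x := fun x =>
    hθc.continuous.integral_hasStrictDerivAt 0 x |>.hasDerivAt
  have hφderiv : deriv φ = θ := funext fun x => (hφd x).deriv
  have hφa : ∀ x, x ∉ Icc a b → φ x = 0 := by
    intro x hx
    have h0a : 0 < a := (hKI haK).1
    have hab : a ≤ b := ha hbK
    rcases lt_or_ge x a with hxa | hxa
    · refine intervalIntegral.integral_zero_ae (Eventually.of_forall fun t ht => hθK t fun htK => ?_)
      have h1 := ha htK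
      have h2 : t ≤ max 0 x := ht.2
      have : max 0 x < a := max_lt h0a hxa
      linarith
    · have hxb : b < x := by
        by_contra hcon
        exact hx ⟨hxa, not_lt.1 hcon⟩
      have : φ x = ∫ t, θ t := by
        have h0x : (0 : ℝ) ≤ x := by linarith
        change ∫ t in (0 : ℝ)..x, θ t = _
        rw [intervalIntegral.integral_of_le h0x, setIntegral_eq_integral_of_forall_compl_eq_zero]
        intro t ht
        refine hθK t fun htK => ht ⟨(hKI htK).1, (hb htK).trans hxb.le⟩
      rw [this, hθ0]
  have hφ : IsTestFunction (Ioo 0 L) φ := by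
    refine ⟨contDiff_infty_iff_deriv.2 ⟨fun x => (hφd x).differentiableAt, hφderiv ▸ hθc⟩,
      HasCompactSupport.intro isCompact_Icc hφa, ?_⟩
    refine (closure_minimal (fun x hx => ?_) isClosed_Icc : tsupport φ ⊆ Icc a b).trans ?_
    · by_contra hcon
      exact hx (hφa x hcon)
    · exact fun x hx => ⟨(hKI haK).1.trans_le hx.1, hx.2.trans_lt (hKI hbK).2⟩
  have h0 := h φ hφ
  rw [hφderiv] at h0
  have e1 : ∫ x in Ioo 0 L, f x * θ x
      = (∫ x in Ioo 0 L, f x * ψ x) - m * c := by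
    rw [hc, ← integral_const_mul, ← integral_sub (hψ.integrable hf) ((hψ₀.integrable hf).const_mul m)]
    congr 1
    ext x
    simp only [θ]; ring
  have e2 : ∫ x in Ioo 0 L, (f x - c) * ψ x = (∫ x in Ioo 0 L, f x * ψ x) - c * m := by
    have : m = ∫ x in Ioo 0 L, ψ x := by
      rw [setIntegral_eq_integral_of_forall_compl_eq_zero]
      exact fun x hx => image_eq_zero_of_notMem_tsupport fun hx' => hx (hψ.tsupport_subset hx')
    rw [this, ← integral_const_mul,
      ← integral_sub (hψ.integrable hf) ((hψi.integrableOn).const_mul c)]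
    congr 1
    ext x
    ring
  rw [e2]
  linarith [e1.symm.trans h0, mul_comm m c]

theorem IsWeakDeriv.unique {f g g' : L2 L} (h : IsWeakDeriv f g) (h' : IsWeakDeriv f g') :
    g = g' := by
  have : (fun x => g x - g' x) =ᵐ[volume.restrict (Ioo 0 L)] 0 := by
    refine ae_eq_zero_of_test (g.integrable.sub g'.integrable) fun φ hφ => ?_
    simp only [sub_mul]
    rw [integral_sub (hφ.integrable g.integrable) (hφ.integrable g'.integrable)]
    linarith [h φ hφ, h' φ hφ]
  apply Lp.ext
  filter_upwards [this] with x hx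
  exact sub_eq_zero.1 hx

theorem IsWeakDeriv.zero : IsWeakDeriv (0 : L2 L) 0 := by
  intro φ _
  have e : ∀ χ : ℝ → ℝ, ∫ x in Ioo 0 L, (0 : L2 L) x * χ x = 0 := fun χ => by
    refine integral_eq_zero_of_ae ?_
    filter_upwards [Lp.coeFn_zero ℝ 2 (volume.restrict (Ioo 0 L))] with x hx
    rw [hx]; simp
  rw [e, e, neg_zero]

theorem IsWeakDeriv.add {f g f' g' : L2 L} (h : IsWeakDeriv f g) (h' : IsWeakDeriv f' g') :
    IsWeakDeriv (f + f') (g + g') := by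
  intro φ hφ
  have e : ∀ (p q : L2 L) (χ : ℝ → ℝ), IsTestFunction (Ioo 0 L) χ →
      ∫ x in Ioo 0 L, (p + q : L2 L) x * χ x
        = (∫ x in Ioo 0 L, p x * χ x) + ∫ x in Ioo 0 L, q x * χ x := fun p q χ hχ => by
    rw [← integral_add (hχ.integrable p.integrable) (hχ.integrable q.integrable)]
    refine integral_congr_ae ?_
    filter_upwards [Lp.coeFn_add p q] with x hx
    rw [hx, Pi.add_apply, add_mul]
  rw [e _ _ _ hφ.deriv, e _ _ _ hφ, h φ hφ, h' φ hφ]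
  ring

theorem IsWeakDeriv.smul {f g : L2 L} (c : ℝ) (h : IsWeakDeriv f g) :
    IsWeakDeriv (c • f) (c • g) := by
  intro φ hφ
  have e : ∀ (p : L2 L) (χ : ℝ → ℝ),
      ∫ x in Ioo 0 L, (c • p : L2 L) x * χ x = c * ∫ x in Ioo 0 L, p x * χ x := fun p χ => by
    rw [← integral_const_mul]
    refine integral_congr_ae ?_
    filter_upwards [Lp.coeFn_smul c p] with x hx
    rw [hx, Pi.smul_apply, smul_eq_mul, mul_assoc]
  rw [e, e, h φ hφ]
  ring

/-- An `L²` function with a weak derivative in `L²` is the primitive of that derivative. -/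
theorem IsWeakDeriv.ae_eq_primitive (hL : 0 < L) {f g : L2 L} (h : IsWeakDeriv f g) :
    ∃ c : ℝ, f =ᵐ[volume.restrict (Ioo 0 L)] fun x => c + ∫ t in (0 : ℝ)..x, g t := by
  have hg : IntervalIntegrable g volume 0 L := by
    rw [intervalIntegrable_iff_integrableOn_Ioo_of_le hL.le]
    exact g.integrable
  let G : ℝ → ℝ := fun x => ∫ t in (0 : ℝ)..x, g t
  have hGac : AbsolutelyContinuousOnInterval G 0 L :=
    hg.absolutelyContinuousOnInterval_intervalIntegral (by simp)
  have hGi : Integrable G (volume.restrict (Ioo 0 L)) := by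
    have := hGac.continuousOn
    rw [uIcc_of_le hL.le] at this
    exact (this.integrableOn_compact isCompact_Icc).mono_set Ioo_subset_Icc_self
  have hG : ∀ φ : ℝ → ℝ, IsTestFunction (Ioo 0 L) φ →
      ∫ x in Ioo 0 L, G x * deriv φ x = -∫ x in Ioo 0 L, g x * φ x := fun φ hφ => by
    have hac : AbsolutelyContinuousOnInterval φ 0 L :=
      ((hφ.contDiff.of_le (by exact_mod_cast le_top)).contDiffOn
        (s := uIcc 0 L)).absolutelyContinuousOnInterval
    have := hGac.integral_mul_deriv_eq_deriv_mul hac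
    have h0 : φ 0 = 0 := image_eq_zero_of_notMem_tsupport fun hx =>
      lt_irrefl _ (hφ.tsupport_subset hx).1
    have h1 : φ L = 0 := image_eq_zero_of_notMem_tsupport fun hx =>
      lt_irrefl _ (hφ.tsupport_subset hx).2
    rw [h0, h1] at this
    have hd : ∫ x in (0 : ℝ)..L, deriv G x * φ x = ∫ x in (0 : ℝ)..L, g x * φ x := by
      refine intervalIntegral.integral_congr_ae ?_
      filter_upwards [hg.ae_hasDerivAt_integral] with x hx hx'
      rw [(hx (uIoc_subset_uIcc hx') 0 (by simp)).deriv]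
    rw [hd] at this
    simpa [intervalIntegral.integral_of_le hL.le, integral_Ioc_eq_integral_Ioo] using this
  obtain ⟨c, hc⟩ := ae_eq_const_of_test hL (f := fun x => f x - G x) (f.integrable.sub hGi)
    fun φ hφ => by
      simp only [sub_mul]
      rw [integral_sub (hφ.deriv.integrable f.integrable) (hφ.deriv.integrable hGi), h φ hφ, hG φ hφ]
      ring
  refine ⟨c, ?_⟩
  filter_upwards [hc] with x hx
  linarith

theorem IsWeakDeriv.exists_rep {f g : L2 L} (h : IsWeakDeriv f g) :
    ∃ F : ℝ → ℝ, ContinuousOn F (Icc 0 L) ∧ f =ᵐ[volume.restrict (Ioo 0 L)] F := by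
  rcases le_or_gt L 0 with hL | hL
  · refine ⟨0, continuousOn_const, ?_⟩
    rw [EventuallyEq, ae_restrict_iff' measurableSet_Ioo]
    exact Eventually.of_forall fun x hx => absurd (hx.1.trans hx.2) (not_lt.2 hL)
  · obtain ⟨c, hc⟩ := h.ae_eq_primitive hL
    refine ⟨_, ?_, hc⟩
    have hg : IntervalIntegrable g volume 0 L := by
      rw [intervalIntegrable_iff_integrableOn_Ioo_of_le hL.le]
      exact g.integrable
    have := (hg.absolutelyContinuousOnInterval_intervalIntegral (c := 0) (by simp)).continuousOn
    rw [uIcc_of_le hL.le] at this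
    exact continuousOn_const.add this

theorem HasTrace.zero (a : ℝ) : HasTrace (0 : L2 L) a 0 :=
  ⟨0, continuousOn_const, Lp.coeFn_zero ℝ 2 _, rfl⟩

theorem HasTrace.add {f f' : L2 L} {a c c' : ℝ} (h : HasTrace f a c) (h' : HasTrace f' a c') :
    HasTrace (f + f') a (c + c') := by
  obtain ⟨F, hF, hfF, rfl⟩ := h
  obtain ⟨F', hF', hfF', rfl⟩ := h'
  refine ⟨fun x => F x + F' x, hF.add hF', ?_, rfl⟩
  filter_upwards [Lp.coeFn_add f f', hfF, hfF'] with x h1 h2 h3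
  rw [h1, Pi.add_apply, h2, h3]

theorem HasTrace.smul {f : L2 L} {a c : ℝ} (r : ℝ) (h : HasTrace f a c) :
    HasTrace (r • f) a (r * c) := by
  obtain ⟨F, hF, hfF, rfl⟩ := h
  refine ⟨fun x => r * F x, continuousOn_const.mul hF, ?_, rfl⟩
  filter_upwards [Lp.coeFn_smul r f, hfF] with x h1 h2
  rw [h1, Pi.smul_apply, h2, smul_eq_mul]

theorem eqOn_of_ae_eq (hL : 0 < L) {F G : ℝ → ℝ} (hF : ContinuousOn F (Icc 0 L))
    (hG : ContinuousOn G (Icc 0 L)) (h : F =ᵐ[volume.restrict (Ioo 0 L)] G) :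
    EqOn F G (Icc 0 L) := by
  have h' : F =ᵐ[volume.restrict (Icc 0 L)] G := by
    rwa [restrict_Ioo_eq_restrict_Icc] at h
  exact Measure.eqOn_Icc_of_ae_eq volume hL.ne h' hF hG

theorem HasTrace.unique (hL : 0 < L) {f : L2 L} {a c c' : ℝ} (ha : a ∈ Icc 0 L)
    (h : HasTrace f a c) (h' : HasTrace f a c') : c = c' := by
  obtain ⟨F, hF, hfF, rfl⟩ := h
  obtain ⟨F', hF', hfF', rfl⟩ := h'
  exact eqOn_of_ae_eq hL hF hF' (hfF.symm.trans hfF') ha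

theorem eq_zero_of_weakDeriv_zero (hL : 0 < L) {f : L2 L} (h : IsWeakDeriv f 0)
    (h0 : HasTrace f 0 0) : f = 0 := by
  obtain ⟨c, hc⟩ := ae_eq_const_of_test hL f.integrable fun φ hφ => by
    rw [h φ hφ, neg_eq_zero]
    refine integral_eq_zero_of_ae ?_
    filter_upwards [Lp.coeFn_zero ℝ 2 (volume.restrict (Ioo 0 L))] with x hx
    rw [hx]; simp
  have hc0 : c = 0 := HasTrace.unique hL ⟨le_rfl, hL.le⟩ ⟨_, continuousOn_const, hc, rfl⟩ h0
  apply Lp.ext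
  filter_upwards [Lp.coeFn_zero ℝ 2 (volume.restrict (Ioo 0 L)), hc] with x h1 h2
  rw [h1, h2, hc0]; rfl

/-- The Sobolev space `H¹(0, L)`. -/
def H1 (L : ℝ) : Submodule ℝ (L2 L) where
  carrier := {f | ∃ g, IsWeakDeriv f g}
  add_mem' := fun ⟨g, hg⟩ ⟨g', hg'⟩ => ⟨g + g', hg.add hg'⟩
  zero_mem' := ⟨0, IsWeakDeriv.zero⟩
  smul_mem' := fun c _ ⟨g, hg⟩ => ⟨c • g, hg.smul c⟩

/-- The Sobolev space `H²(0, L)`. -/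
def H2 (L : ℝ) : Submodule ℝ (L2 L) where
  carrier := {f | ∃ g ∈ H1 L, IsWeakDeriv f g}
  add_mem' := fun ⟨g, hg1, hg⟩ ⟨g', hg1', hg'⟩ => ⟨g + g', add_mem hg1 hg1', hg.add hg'⟩
  zero_mem' := ⟨0, zero_mem _, IsWeakDeriv.zero⟩
  smul_mem' := fun c _ ⟨g, hg1, hg⟩ => ⟨c • g, Submodule.smul_mem _ c hg1, hg.smul c⟩

/-- `H¹_*(0, L)`: the functions in `H¹(0, L)` that vanish at `0`. -/
def H1star (L : ℝ) : Submodule ℝ (L2 L) where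
  carrier := {f | f ∈ H1 L ∧ HasTrace f 0 0}
  add_mem' := fun h h' => ⟨add_mem h.1 h'.1, by simpa using h.2.add h'.2⟩
  zero_mem' := ⟨zero_mem _, HasTrace.zero 0⟩
  smul_mem' := fun c _ h => ⟨Submodule.smul_mem _ c h.1, by simpa using h.2.smul c⟩

open Classical in
/-- The weak derivative of `f`; it is only used for `f ∈ H¹(0, L)` (and is `0` otherwise). -/
def D (f : L2 L) : L2 L := if h : ∃ g, IsWeakDeriv f g then h.choose else 0

open Classical in
/-- The value `f(a)`; it is only used for `f ∈ H¹(0, L)` and `a ∈ [0, L]`, where it is the value of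
the continuous representative. -/
def trace (a : ℝ) (f : L2 L) : ℝ := if h : ∃ c, HasTrace f a c then h.choose else 0

theorem isWeakDeriv_D {f : L2 L} (hf : f ∈ H1 L) : IsWeakDeriv f (D f) := by
  have h : ∃ g, IsWeakDeriv f g := hf
  rw [D, dif_pos h]
  exact h.choose_spec

theorem IsWeakDeriv.D_eq {f g : L2 L} (h : IsWeakDeriv f g) : D f = g :=
  (isWeakDeriv_D ⟨g, h⟩).unique h

theorem D_add {f g : L2 L} (hf : f ∈ H1 L) (hg : g ∈ H1 L) : D (f + g) = D f + D g :=
  ((isWeakDeriv_D hf).add (isWeakDeriv_D hg)).D_eq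

theorem D_smul {f : L2 L} (c : ℝ) (hf : f ∈ H1 L) : D (c • f) = c • D f :=
  ((isWeakDeriv_D hf).smul c).D_eq

theorem D_mem_H1 {f : L2 L} (hf : f ∈ H2 L) : D f ∈ H1 L := by
  obtain ⟨g, hg, h⟩ := hf
  exact h.D_eq ▸ hg

theorem H2_le_H1 : H2 L ≤ H1 L := fun _ ⟨g, _, h⟩ => ⟨g, h⟩

theorem hasTrace_trace {f : L2 L} (hf : f ∈ H1 L) (a : ℝ) : HasTrace f a (trace a f) := by
  obtain ⟨g, hg⟩ := hf
  obtain ⟨F, hF, hfF⟩ := hg.exists_rep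
  have h : ∃ c, HasTrace f a c := ⟨F a, F, hF, hfF, rfl⟩
  rw [trace, dif_pos h]
  exact h.choose_spec

theorem trace_add (hL : 0 < L) {a : ℝ} (ha : a ∈ Icc 0 L) {f g : L2 L} (hf : f ∈ H1 L)
    (hg : g ∈ H1 L) : trace a (f + g) = trace a f + trace a g :=
  (hasTrace_trace (add_mem hf hg) a).unique hL ha ((hasTrace_trace hf a).add (hasTrace_trace hg a))

theorem trace_smul (hL : 0 < L) {a : ℝ} (ha : a ∈ Icc 0 L) {f : L2 L} (c : ℝ) (hf : f ∈ H1 L) :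
    trace a (c • f) = c * trace a f :=
  (hasTrace_trace (Submodule.smul_mem _ c hf) a).unique hL ha ((hasTrace_trace hf a).smul c)

end Calculus

/-- The constants of the laminated beam: its length and the (positive) physical coefficients. -/
structure Beam where
  L : ℝ
  ρ₁ : ℝ
  ρ₂ : ℝ
  k : ℝ
  b : ℝ
  γ : ℝ
  L_pos : 0 < L
  ρ₁_pos : 0 < ρ₁
  ρ₂_pos : 0 < ρ₂
  k_pos : 0 < k
  b_pos : 0 < b
  γ_pos : 0 < γ

/-- The elements `U = (w, Ψ₁, ξ, Ψ₂, s, Ψ₃, Ψ₄, Ψ₅, Ψ₆)` of the phase space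
`ℋ = [H¹_*(0, L) × L²(0, L)]³ × ℝ³`. -/
@[ext]
structure State (P : Beam) where
  w : H1star P.L
  Ψ₁ : L2 P.L
  ξ : H1star P.L
  Ψ₂ : L2 P.L
  s : H1star P.L
  Ψ₃ : L2 P.L
  Ψ₄ : ℝ
  Ψ₅ : ℝ
  Ψ₆ : ℝ

namespace State

variable {P : Beam}

/-- Auxiliary: a state as an element of the Cartesian product (used for the vector space
operations, which are componentwise). -/
def equivProd : State P ≃ (H1star P.L × L2 P.L × H1star P.L × L2 P.L × H1star P.L × L2 P.L ×
    ℝ × ℝ × ℝ) where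
  toFun U := (U.w, U.Ψ₁, U.ξ, U.Ψ₂, U.s, U.Ψ₃, U.Ψ₄, U.Ψ₅, U.Ψ₆)
  invFun p := ⟨p.1, p.2.1, p.2.2.1, p.2.2.2.1, p.2.2.2.2.1, p.2.2.2.2.2.1, p.2.2.2.2.2.2.1,
    p.2.2.2.2.2.2.2.1, p.2.2.2.2.2.2.2.2⟩
  left_inv _ := rfl
  right_inv _ := rfl

instance : AddCommGroup (State P) := equivProd.addCommGroup

instance : Module ℝ (State P) := equivProd.module ℝ

@[simp] theorem zero_w : (0 : State P).w = 0 := rfl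
@[simp] theorem zero_Ψ₁ : (0 : State P).Ψ₁ = 0 := rfl
@[simp] theorem zero_ξ : (0 : State P).ξ = 0 := rfl
@[simp] theorem zero_Ψ₂ : (0 : State P).Ψ₂ = 0 := rfl
@[simp] theorem zero_s : (0 : State P).s = 0 := rfl
@[simp] theorem zero_Ψ₃ : (0 : State P).Ψ₃ = 0 := rfl
@[simp] theorem zero_Ψ₄ : (0 : State P).Ψ₄ = 0 := rfl
@[simp] theorem zero_Ψ₅ : (0 : State P).Ψ₅ = 0 := rfl
@[simp] theorem zero_Ψ₆ : (0 : State P).Ψ₆ = 0 := rfl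

@[simp] theorem add_w (U V : State P) : (U + V).w = U.w + V.w := rfl
@[simp] theorem add_Ψ₁ (U V : State P) : (U + V).Ψ₁ = U.Ψ₁ + V.Ψ₁ := rfl
@[simp] theorem add_ξ (U V : State P) : (U + V).ξ = U.ξ + V.ξ := rfl
@[simp] theorem add_Ψ₂ (U V : State P) : (U + V).Ψ₂ = U.Ψ₂ + V.Ψ₂ := rfl
@[simp] theorem add_s (U V : State P) : (U + V).s = U.s + V.s := rfl
@[simp] theorem add_Ψ₃ (U V : State P) : (U + V).Ψ₃ = U.Ψ₃ + V.Ψ₃ := rfl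
@[simp] theorem add_Ψ₄ (U V : State P) : (U + V).Ψ₄ = U.Ψ₄ + V.Ψ₄ := rfl
@[simp] theorem add_Ψ₅ (U V : State P) : (U + V).Ψ₅ = U.Ψ₅ + V.Ψ₅ := rfl
@[simp] theorem add_Ψ₆ (U V : State P) : (U + V).Ψ₆ = U.Ψ₆ + V.Ψ₆ := rfl

@[simp] theorem smul_w (c : ℝ) (U : State P) : (c • U).w = c • U.w := rfl
@[simp] theorem smul_Ψ₁ (c : ℝ) (U : State P) : (c • U).Ψ₁ = c • U.Ψ₁ := rfl
@[simp] theorem smul_ξ (c : ℝ) (U : State P) : (c • U).ξ = c • U.ξ := rfl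
@[simp] theorem smul_Ψ₂ (c : ℝ) (U : State P) : (c • U).Ψ₂ = c • U.Ψ₂ := rfl
@[simp] theorem smul_s (c : ℝ) (U : State P) : (c • U).s = c • U.s := rfl
@[simp] theorem smul_Ψ₃ (c : ℝ) (U : State P) : (c • U).Ψ₃ = c • U.Ψ₃ := rfl
@[simp] theorem smul_Ψ₄ (c : ℝ) (U : State P) : (c • U).Ψ₄ = c * U.Ψ₄ := rfl
@[simp] theorem smul_Ψ₅ (c : ℝ) (U : State P) : (c • U).Ψ₅ = c * U.Ψ₅ := rfl
@[simp] theorem smul_Ψ₆ (c : ℝ) (U : State P) : (c • U).Ψ₆ = c * U.Ψ₆ := rfl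

/-- `w_x + ξ + s`. -/
def shear (U : State P) : L2 P.L := D (U.w : L2 P.L) + U.ξ + U.s

theorem D_add_coe (f g : H1star P.L) :
    D ((f : L2 P.L) + (g : L2 P.L)) = D (f : L2 P.L) + D (g : L2 P.L) :=
  D_add f.2.1 g.2.1

theorem D_smul_coe (c : ℝ) (f : H1star P.L) :
    D (c • (f : L2 P.L)) = c • D (f : L2 P.L) :=
  D_smul c f.2.1

theorem shear_add (U V : State P) : (U + V).shear = U.shear + V.shear := by
  simp only [shear, add_w, add_ξ, add_s, D_add_coe, Submodule.coe_add]
  abel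

theorem shear_smul (c : ℝ) (U : State P) : (c • U).shear = c • U.shear := by
  simp only [shear, smul_w, smul_ξ, smul_s, D_smul_coe, Submodule.coe_smul, smul_add]

theorem eq_zero_of_D_eq_zero {f : H1star P.L} (h : D (f : L2 P.L) = 0) : f = 0 :=
  Subtype.ext (eq_zero_of_weakDeriv_zero P.L_pos (h ▸ isWeakDeriv_D f.2.1) f.2.2)

/-- The energy inner product of the phase space. -/
@[reducible]
def innerCore (P : Beam) : InnerProductSpace.Core ℝ (State P) where
  inner U V :=
    3 * P.ρ₁ * inner ℝ U.Ψ₁ V.Ψ₁ + 3 * P.ρ₂ * inner ℝ U.Ψ₂ V.Ψ₂ + P.ρ₂ * inner ℝ U.Ψ₃ V.Ψ₃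
    + 3 * P.b * inner ℝ (D (U.ξ : L2 P.L)) (D (V.ξ : L2 P.L))
    + P.b * inner ℝ (D (U.s : L2 P.L)) (D (V.s : L2 P.L))
    + P.γ * inner ℝ (U.s : L2 P.L) (V.s : L2 P.L)
    + 3 * P.k * inner ℝ U.shear V.shear
    + 3 * P.k * (U.Ψ₄ * V.Ψ₄) + 3 * P.b * (U.Ψ₅ * V.Ψ₅) + P.b * (U.Ψ₆ * V.Ψ₆)
  conj_inner_symm U V := by
    simp only [conj_trivial, real_inner_comm, mul_comm V.Ψ₄, mul_comm V.Ψ₅, mul_comm V.Ψ₆]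
  re_inner_nonneg U := by
    have := P.ρ₁_pos; have := P.ρ₂_pos; have := P.k_pos; have := P.b_pos; have := P.γ_pos
    simp only [real_inner_self_eq_norm_sq, RCLike.re_to_real, ← sq]
    positivity
  add_left U V W := by
    simp only [shear_add, add_Ψ₁, add_Ψ₂, add_Ψ₃, add_Ψ₄, add_Ψ₅, add_Ψ₆, add_ξ, add_s,
      D_add_coe, Submodule.coe_add, inner_add_left]
    ring
  smul_left U V c := by
    simp only [shear_smul, smul_Ψ₁, smul_Ψ₂, smul_Ψ₃, smul_Ψ₄, smul_Ψ₅, smul_Ψ₆, smul_ξ, smul_s,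
      D_smul_coe, Submodule.coe_smul, real_inner_smul_left, conj_trivial]
    ring
  definite U h := by
    have h1 := P.ρ₁_pos
    have h2 := P.ρ₂_pos
    have h3 := P.k_pos
    have h4 := P.b_pos
    have h5 := P.γ_pos
    simp only [real_inner_self_eq_norm_sq, ← sq] at h
    have a1 : 0 ≤ 3 * P.ρ₁ * ‖U.Ψ₁‖ ^ 2 := by positivity
    have a2 : 0 ≤ 3 * P.ρ₂ * ‖U.Ψ₂‖ ^ 2 := by positivity
    have a3 : 0 ≤ P.ρ₂ * ‖U.Ψ₃‖ ^ 2 := by positivity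
    have a4 : 0 ≤ 3 * P.b * ‖D (U.ξ : L2 P.L)‖ ^ 2 := by positivity
    have a5 : 0 ≤ P.b * ‖D (U.s : L2 P.L)‖ ^ 2 := by positivity
    have a6 : 0 ≤ P.γ * ‖(U.s : L2 P.L)‖ ^ 2 := by positivity
    have a7 : 0 ≤ 3 * P.k * ‖U.shear‖ ^ 2 := by positivity
    have a8 : 0 ≤ 3 * P.k * U.Ψ₄ ^ 2 := by positivity
    have a9 : 0 ≤ 3 * P.b * U.Ψ₅ ^ 2 := by positivity
    have a10 : 0 ≤ P.b * U.Ψ₆ ^ 2 := by positivity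
    have z : ∀ {c x : ℝ}, 0 < c → c * x ^ 2 ≤ 0 → x = 0 := fun {c x} hc hx => by
      by_contra hne
      have : 0 < c * x ^ 2 := by positivity
      linarith
    have b1 : U.Ψ₁ = 0 := norm_eq_zero.1 (z (c := 3 * P.ρ₁) (by positivity) (by linarith))
    have b2 : U.Ψ₂ = 0 := norm_eq_zero.1 (z (c := 3 * P.ρ₂) (by positivity) (by linarith))
    have b3 : U.Ψ₃ = 0 := norm_eq_zero.1 (z h2 (by linarith))
    have b4 : U.ξ = 0 := eq_zero_of_D_eq_zero
      (norm_eq_zero.1 (z (c := 3 * P.b) (by positivity) (by linarith)))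
    have b5 : U.s = 0 := eq_zero_of_D_eq_zero (norm_eq_zero.1 (z h4 (by linarith)))
    have b7 : U.shear = 0 := norm_eq_zero.1 (z (c := 3 * P.k) (by positivity) (by linarith))
    have b6 : U.w = 0 := eq_zero_of_D_eq_zero (by simpa [shear, b4, b5] using b7)
    have b8 : U.Ψ₄ = 0 := z (c := 3 * P.k) (by positivity) (by linarith)
    have b9 : U.Ψ₅ = 0 := z (c := 3 * P.b) (by positivity) (by linarith)
    have b10 : U.Ψ₆ = 0 := z h4 (by linarith)
    exact State.ext b6 b1 b4 b2 b5 b3 b8 b9 b10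

instance : NormedAddCommGroup (State P) := (innerCore P).toNormedAddCommGroup

instance : InnerProductSpace ℝ (State P) := InnerProductSpace.ofCore (innerCore P).toCore

/-- The domain `D(𝒜)`. -/
def domain (P : Beam) : Submodule ℝ (State P) where
  carrier := {U | ((U.w : L2 P.L) ∈ H2 P.L ∧ (U.ξ : L2 P.L) ∈ H2 P.L ∧ (U.s : L2 P.L) ∈ H2 P.L) ∧
    (U.Ψ₁ ∈ H1star P.L ∧ U.Ψ₂ ∈ H1star P.L ∧ U.Ψ₃ ∈ H1star P.L) ∧
    HasTrace U.Ψ₁ P.L U.Ψ₄ ∧ HasTrace U.Ψ₂ P.L U.Ψ₅ ∧ HasTrace U.Ψ₃ P.L U.Ψ₆}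
  add_mem' := fun ⟨⟨a1, a2, a3⟩, ⟨a4, a5, a6⟩, a7, a8, a9⟩ ⟨⟨b1, b2, b3⟩, ⟨b4, b5, b6⟩, b7, b8, b9⟩ =>
    ⟨⟨add_mem a1 b1, add_mem a2 b2, add_mem a3 b3⟩,
      ⟨add_mem a4 b4, add_mem a5 b5, add_mem a6 b6⟩, a7.add b7, a8.add b8, a9.add b9⟩
  zero_mem' := ⟨⟨zero_mem _, zero_mem _, zero_mem _⟩, ⟨zero_mem _, zero_mem _, zero_mem _⟩,
    HasTrace.zero _, HasTrace.zero _, HasTrace.zero _⟩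
  smul_mem' := fun c _ ⟨⟨a1, a2, a3⟩, ⟨a4, a5, a6⟩, a7, a8, a9⟩ =>
    ⟨⟨Submodule.smul_mem _ c a1, Submodule.smul_mem _ c a2, Submodule.smul_mem _ c a3⟩,
      ⟨Submodule.smul_mem _ c a4, Submodule.smul_mem _ c a5, Submodule.smul_mem _ c a6⟩,
      a7.smul c, a8.smul c, a9.smul c⟩

theorem shear_mem_H1 {U : State P} (hU : U ∈ domain P) : U.shear ∈ H1 P.L :=
  add_mem (add_mem (D_mem_H1 hU.1.1) U.ξ.2.1) U.s.2.1

end State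

/-- The operator `𝒜 : D(𝒜) ⊆ ℋ → ℋ` of the laminated beam. -/
def Beam.operator (P : Beam) : State P →ₗ.[ℝ] State P where
  domain := State.domain P
  toFun :=
    { toFun := fun U =>
        { w := ⟨U.1.Ψ₁, U.2.2.1.1⟩
          Ψ₁ := (1 / P.ρ₁) • (P.k • D U.1.shear)
          ξ := ⟨U.1.Ψ₂, U.2.2.1.2.1⟩
          Ψ₂ := (1 / P.ρ₂) • (P.b • D (D (U.1.ξ : L2 P.L)) - P.k • U.1.shear)
          s := ⟨U.1.Ψ₃, U.2.2.1.2.2⟩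
          Ψ₃ := (1 / P.ρ₂) • (P.b • D (D (U.1.s : L2 P.L)) - (3 * P.k) • U.1.shear
            - P.γ • (U.1.s : L2 P.L))
          Ψ₄ := -(trace P.L (D (U.1.w : L2 P.L)) + trace P.L (U.1.ξ : L2 P.L)
            + trace P.L (U.1.s : L2 P.L))
          Ψ₅ := -trace P.L (D (U.1.ξ : L2 P.L))
          Ψ₆ := -trace P.L (D (U.1.s : L2 P.L)) }
      map_add' := by
        rintro ⟨U, hU⟩ ⟨V, hV⟩
        have hL := P.L_pos
        have hm : P.L ∈ Icc 0 P.L := ⟨hL.le, le_rfl⟩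
        apply State.ext
        · rfl
        · simp only [State.add_Ψ₁, Submodule.coe_add, State.shear_add,
            D_add (State.shear_mem_H1 hU) (State.shear_mem_H1 hV), smul_add]
        · rfl
        · simp only [State.add_Ψ₂, Submodule.coe_add, State.shear_add, State.add_ξ,
            D_add U.ξ.2.1 V.ξ.2.1, D_add (D_mem_H1 hU.1.2.1) (D_mem_H1 hV.1.2.1)]
          module
        · rfl
        · simp only [State.add_Ψ₃, Submodule.coe_add, State.shear_add, State.add_s,
            D_add U.s.2.1 V.s.2.1, D_add (D_mem_H1 hU.1.2.2) (D_mem_H1 hV.1.2.2)]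
          module
        · simp only [State.add_Ψ₄, Submodule.coe_add, State.add_w, State.add_ξ, State.add_s,
            D_add U.w.2.1 V.w.2.1, trace_add hL hm (D_mem_H1 hU.1.1) (D_mem_H1 hV.1.1),
            trace_add hL hm U.ξ.2.1 V.ξ.2.1, trace_add hL hm U.s.2.1 V.s.2.1]
          ring
        · simp only [State.add_Ψ₅, Submodule.coe_add, State.add_ξ,
            D_add U.ξ.2.1 V.ξ.2.1, trace_add hL hm (D_mem_H1 hU.1.2.1) (D_mem_H1 hV.1.2.1)]
          ring
        · simp only [State.add_Ψ₆, Submodule.coe_add, State.add_s,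
            D_add U.s.2.1 V.s.2.1, trace_add hL hm (D_mem_H1 hU.1.2.2) (D_mem_H1 hV.1.2.2)]
          ring
      map_smul' := by
        rintro c ⟨U, hU⟩
        have hL := P.L_pos
        have hm : P.L ∈ Icc 0 P.L := ⟨hL.le, le_rfl⟩
        apply State.ext
        · rfl
        · simp only [RingHom.id_apply, State.smul_Ψ₁, Submodule.coe_smul, State.shear_smul,
            D_smul c (State.shear_mem_H1 hU)]
          module
        · rfl
        · simp only [RingHom.id_apply, State.smul_Ψ₂, Submodule.coe_smul, State.shear_smul,
            State.smul_ξ, D_smul c U.ξ.2.1, D_smul c (D_mem_H1 hU.1.2.1)]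
          module
        · rfl
        · simp only [RingHom.id_apply, State.smul_Ψ₃, Submodule.coe_smul, State.shear_smul,
            State.smul_s, D_smul c U.s.2.1, D_smul c (D_mem_H1 hU.1.2.2)]
          module
        · simp only [RingHom.id_apply, State.smul_Ψ₄, Submodule.coe_smul, State.smul_w,
            State.smul_ξ, State.smul_s, D_smul c U.w.2.1, trace_smul hL hm c (D_mem_H1 hU.1.1),
            trace_smul hL hm c U.ξ.2.1, trace_smul hL hm c U.s.2.1]
          ring
        · simp only [RingHom.id_apply, State.smul_Ψ₅, Submodule.coe_smul, State.smul_ξ,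
            D_smul c U.ξ.2.1, trace_smul hL hm c (D_mem_H1 hU.1.2.1)]
          ring
        · simp only [RingHom.id_apply, State.smul_Ψ₆, Submodule.coe_smul, State.smul_s,
            D_smul c U.s.2.1, trace_smul hL hm c (D_mem_H1 hU.1.2.2)]
          ring }

/-- `U ∈ C([0, ∞); D(A))`, where `D(A)` carries the graph norm of `A`: on `[0, ∞)`, `U` takes values
in `D(A)` and both `U` and `A U` are continuous. -/
def ContinuousInDomain {H : Type*} [NormedAddCommGroup H] [NormedSpace ℝ H] (A : H →ₗ.[ℝ] H)
    (U : ℝ → H) : Prop :=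
  ∃ hU : ∀ t : Ici (0 : ℝ), U t ∈ A.domain,
    Continuous (fun t : Ici (0 : ℝ) => U t) ∧
    Continuous (fun t : Ici (0 : ℝ) => A ⟨U t, hU t⟩)

/-- The curve `U = (w, w_t, ξ, ξ_t, s, s_t, w_t(L, ·), ξ_t(L, ·), s_t(L, ·))` solves the laminated
beam system with controls `u₁, u₂, u₃` and initial state `U₀`. Time derivatives of `w, ξ, s` and of
`w_t, ξ_t, s_t` are derivatives of curves in `L²(0, L)`, and the equations hold in `L²(0, L)` for
every `t > 0`. -/
structure SolvesSystem (P : Beam) (u₁ u₂ u₃ : ℝ → ℝ) (U₀ : State P) (U : ℝ → State P) :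
    Prop where
  /-- `Ψ₁ = w_t`, `Ψ₂ = ξ_t`, `Ψ₃ = s_t` -/
  w_t : ∀ t > 0, HasDerivAt (fun τ => ((U τ).w : L2 P.L)) (U t).Ψ₁ t
  ξ_t : ∀ t > 0, HasDerivAt (fun τ => ((U τ).ξ : L2 P.L)) (U t).Ψ₂ t
  s_t : ∀ t > 0, HasDerivAt (fun τ => ((U τ).s : L2 P.L)) (U t).Ψ₃ t
  /-- `Ψ₄ = w_t(L, ·)`, `Ψ₅ = ξ_t(L, ·)`, `Ψ₆ = s_t(L, ·)` -/
  w_t_L : ∀ t > 0, HasTrace (U t).Ψ₁ P.L (U t).Ψ₄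
  ξ_t_L : ∀ t > 0, HasTrace (U t).Ψ₂ P.L (U t).Ψ₅
  s_t_L : ∀ t > 0, HasTrace (U t).Ψ₃ P.L (U t).Ψ₆
  /-- `ρ₁ w_tt - k (w_x + ξ + s)_x = 0` -/
  eq_w : ∀ t > 0, ∃ wtt σx : L2 P.L, HasDerivAt (fun τ => (U τ).Ψ₁) wtt t ∧
    IsWeakDeriv (U t).shear σx ∧
    P.ρ₁ • wtt - P.k • σx = 0
  /-- `ρ₂ ξ_tt - b ξ_xx + k (w_x + ξ + s) = 0` -/
  eq_ξ : ∀ t > 0, ∃ ξtt ξxx : L2 P.L, HasDerivAt (fun τ => (U τ).Ψ₂) ξtt t ∧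
    IsWeakDeriv (D ((U t).ξ : L2 P.L)) ξxx ∧
    P.ρ₂ • ξtt - P.b • ξxx + P.k • (U t).shear = 0
  /-- `ρ₂ s_tt - b s_xx + 3k (w_x + ξ + s) + γ s = 0` -/
  eq_s : ∀ t > 0, ∃ stt sxx : L2 P.L, HasDerivAt (fun τ => (U τ).Ψ₃) stt t ∧
    IsWeakDeriv (D ((U t).s : L2 P.L)) sxx ∧
    P.ρ₂ • stt - P.b • sxx + (3 * P.k) • (U t).shear
      + P.γ • ((U t).s : L2 P.L) = 0
  /-- `w(0, t) = ξ(0, t) = s(0, t) = 0` -/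
  bc_zero : ∀ t > 0, HasTrace ((U t).w : L2 P.L) 0 0 ∧ HasTrace ((U t).ξ : L2 P.L) 0 0 ∧
    HasTrace ((U t).s : L2 P.L) 0 0
  /-- `w_tt(L, t) + w_x(L, t) + ξ(L, t) + s(L, t) = u₁(t)` -/
  bc_w : ∀ t > 0, ∃ wttL wxL ξL sL : ℝ, HasDerivAt (fun τ => (U τ).Ψ₄) wttL t ∧
    HasTrace (D ((U t).w : L2 P.L)) P.L wxL ∧ HasTrace ((U t).ξ : L2 P.L) P.L ξL ∧
    HasTrace ((U t).s : L2 P.L) P.L sL ∧ wttL + wxL + ξL + sL = u₁ t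
  /-- `ξ_tt(L, t) + ξ_x(L, t) = u₂(t)` -/
  bc_ξ : ∀ t > 0, ∃ ξttL ξxL : ℝ, HasDerivAt (fun τ => (U τ).Ψ₅) ξttL t ∧
    HasTrace (D ((U t).ξ : L2 P.L)) P.L ξxL ∧ ξttL + ξxL = u₂ t
  /-- `s_tt(L, t) + s_x(L, t) = u₃(t)` -/
  bc_s : ∀ t > 0, ∃ sttL sxL : ℝ, HasDerivAt (fun τ => (U τ).Ψ₆) sttL t ∧
    HasTrace (D ((U t).s : L2 P.L)) P.L sxL ∧ sttL + sxL = u₃ t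
  /-- initial conditions -/
  init : U 0 = U₀

end LaminatedBeam

end

/-! The system is the evolution equation `U' = A U + F` in the energy space, where `A` is the beam
operator and `F` carries the controls in the last three coordinates. The weights `3k`, `3b`, `b` of
those coordinates are chosen so that the boundary terms produced at `L` by integration by parts
cancel. Hence `⟨A U, U⟩ = 0` on the domain (`Beam.operator_inner_self`): without controls the energy
is conserved.

Uniqueness follows at once. The difference `Z` of two solutions satisfies `Z' = A Z`, so `‖Z‖` is
constant, and `Z` starts at `0`.

Existence also needs `1 - h A` to be onto for every `h ≠ 0`, of either sign
(`Beam.exists_sub_smul_operator`). Its weak form says that a vector is orthogonal to a closed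
subspace of the energy space, so it is solved by an orthogonal projection. Regularity and the
conditions at `L` are then read off from the weak form (`isWeakDeriv_and_hasTrace_of_inner`).

An operator with these two properties generates a group of isometries
(`IsSkewGenerator.exists_isometryGroup`), the limit of the exponentials of bounded skew
approximations of `A`. Duhamel's formula, applied to `U - U'` instead of `U`, then gives a classical
solution (`IsSkewGenerator.exists_solution`). Since every coordinate of the energy space is a
bounded linear map, the abstract equation can be read coordinate by coordinate, in both directions.
-/

noncomputable section

namespace LaminatedBeam

/-! ### Skew operators, their resolvents and Yosida approximations -/

section SkewGenerator

variable {H : Type*} [NormedAddCommGroup H] [InnerProductSpace ℝ H]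

/-- A densely defined skew-adjoint operator, characterised by skew symmetry and the range
condition. -/
structure IsSkewGenerator (A : H →ₗ.[ℝ] H) : Prop where
  inner_self (x : A.domain) : inner ℝ (A x) (x : H) = 0
  exists_sub_smul (h : ℝ) (hh : h ≠ 0) (y : H) : ∃ x : A.domain, (x : H) - h • A x = y

/-- `J h = (1 - h A)⁻¹` for every `h ≠ 0`. -/
def IsResolvent (A : H →ₗ.[ℝ] H) (J : ℝ → H →L[ℝ] H) : Prop :=
  ∀ h : ℝ, h ≠ 0 → ∀ y : H, ∃ hy : J h y ∈ A.domain, J h y - h • A ⟨J h y, hy⟩ = y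

variable {A : H →ₗ.[ℝ] H} {J : ℝ → H →L[ℝ] H}

theorem IsSkewGenerator.inner_comm (hA : IsSkewGenerator A) (x y : A.domain) :
    inner ℝ (A x) (y : H) = -inner ℝ (x : H) (A y) := by
  have h := hA.inner_self (x + y)
  rw [LinearPMap.map_add, Submodule.coe_add, inner_add_left, inner_add_right, inner_add_right,
    hA.inner_self x, hA.inner_self y] at h
  rw [real_inner_comm (A y) (x : H)]
  linarith

/-- Pairing `x - h A x` with `x` leaves `‖x‖²`, and Cauchy–Schwarz concludes. This one estimate
makes `1 - h A` injective and its inverse a contraction, for both signs of `h`. -/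
theorem IsSkewGenerator.norm_le (hA : IsSkewGenerator A) (h : ℝ) (x : A.domain) :
    ‖(x : H)‖ ≤ ‖(x : H) - h • A x‖ := by
  have h1 : inner ℝ ((x : H) - h • A x) (x : H) = ‖(x : H)‖ ^ 2 := by
    rw [inner_sub_left, real_inner_smul_left, hA.inner_self, real_inner_self_eq_norm_sq]
    ring
  have h2 := real_inner_le_norm ((x : H) - h • A x) (x : H)
  rcases (norm_nonneg (x : H)).eq_or_lt with h0 | h0
  · rw [← h0]; positivity
  · nlinarith

theorem IsSkewGenerator.exists_resolvent (hA : IsSkewGenerator A) :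
    ∃ J : ℝ → H →L[ℝ] H, IsResolvent A J := by
  suffices ∀ h : ℝ, ∃ T : H →L[ℝ] H, h ≠ 0 → ∀ y : H, ∃ hy : T y ∈ A.domain,
      T y - h • A ⟨T y, hy⟩ = y by
    choose J hJ using this
    exact ⟨J, hJ⟩
  intro h
  by_cases hh : h = 0
  -- A default value: nothing is claimed about `J 0`.
  · exact ⟨0, fun h' => absurd hh h'⟩
  let T : A.domain →ₗ[ℝ] H := A.domain.subtype - h • A.toFun
  have hT : ∀ x, T x = (x : H) - h • A x := fun x => rfl
  have hTi : Function.Injective T := by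
    refine (injective_iff_map_eq_zero T).2 fun x hx => ?_
    have := hA.norm_le h x
    rw [← hT, hx, norm_zero] at this
    exact Subtype.ext (norm_le_zero_iff.1 this)
  let e := LinearEquiv.ofBijective T ⟨hTi, hA.exists_sub_smul h hh⟩
  have he : ∀ y, ((e.symm y : A.domain) : H) - h • A (e.symm y) = y := fun y =>
    e.apply_symm_apply y
  refine ⟨(A.domain.subtype ∘ₗ (e.symm : H →ₗ[ℝ] A.domain)).mkContinuous 1 fun y => ?_,
    fun _ y => ⟨(e.symm y).2, he y⟩⟩
  have := hA.norm_le h (e.symm y)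
  rw [he] at this
  simpa using this

namespace IsResolvent

theorem norm_le (hJ : IsResolvent A J) (hA : IsSkewGenerator A) {h : ℝ} (hh : h ≠ 0) (y : H) :
    ‖J h y‖ ≤ ‖y‖ := by
  obtain ⟨hy, e⟩ := hJ h hh y
  simpa only [e] using hA.norm_le h ⟨_, hy⟩

theorem apply_sub (hJ : IsResolvent A J) (hA : IsSkewGenerator A) {h : ℝ} (hh : h ≠ 0)
    (x : A.domain) : J h ((x : H) - h • A x) = x := by
  obtain ⟨hy, e⟩ := hJ h hh ((x : H) - h • A x)
  have h1 := hA.norm_le h (⟨_, hy⟩ - x)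
  rw [LinearPMap.map_sub, Submodule.coe_sub, smul_sub, sub_sub_sub_comm, e, sub_self,
    norm_zero] at h1
  exact sub_eq_zero.1 (norm_le_zero_iff.1 h1)

theorem smul_apply (hJ : IsResolvent A J) (hA : IsSkewGenerator A) {h : ℝ} (hh : h ≠ 0)
    (x : A.domain) : h • J h (A x) = J h x - x := by
  have := hJ.apply_sub hA hh x
  rw [map_sub, map_smul] at this
  rw [eq_sub_iff_add_eq, ← eq_sub_iff_add_eq']
  exact this.symm

theorem apply_op (hJ : IsResolvent A J) (hA : IsSkewGenerator A) {h : ℝ} (hh : h ≠ 0)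
    (x : A.domain) : A ⟨J h x, (hJ h hh x).1⟩ = J h (A x) := by
  have h1 := (hJ h hh x).2
  refine smul_right_injective H hh ?_
  change h • _ = h • _
  rw [hJ.smul_apply hA hh]
  rw [eq_sub_iff_add_eq', ← eq_sub_iff_add_eq]
  exact h1.symm

/-- Write `y = (1 - h A) (J h y)`. Since `J m` commutes with `A` on the domain, `J m y = (1 - h A)
(J m (J h y))`, and applying `J h` gives the claim. -/
theorem commute (hJ : IsResolvent A J) (hA : IsSkewGenerator A) {h m : ℝ} (hh : h ≠ 0)
    (hm : m ≠ 0) : Commute (J h) (J m) := by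
  ext y
  obtain ⟨hy, e⟩ := hJ h hh y
  change J h (J m y) = J m (J h y)
  have h1 := hJ.apply_op hA hm ⟨_, hy⟩
  have h2 := hJ.apply_sub hA hh ⟨J m (J h y), (hJ m hm _).1⟩
  rw [h1] at h2
  change J h (J m (J h y) - _) = J m (J h y) at h2
  rw [← h2, ← map_smul, ← map_sub, e]

/-- For skew `A` the adjoint of `(1 - h A)⁻¹` is `(1 + h A)⁻¹`; only the diagonal of this relation
is needed. -/
theorem inner_eq (hJ : IsResolvent A J) (hA : IsSkewGenerator A) {h : ℝ} (hh : h ≠ 0) (x : H) :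
    inner ℝ (J h x) x = inner ℝ (J (-h) x) x := by
  obtain ⟨h1, e1⟩ := hJ h hh x
  obtain ⟨h2, e2⟩ := hJ (-h) (neg_ne_zero.2 hh) x
  have e3 := hA.inner_comm ⟨_, h1⟩ ⟨_, h2⟩
  have a1 : inner ℝ (J h x) x = inner ℝ (J h x) (J (-h) x)
      + h * inner ℝ (J h x) (A ⟨_, h2⟩) := by
    have := congrArg (inner ℝ (J h x)) e2
    rw [inner_sub_right, real_inner_smul_right] at this
    linarith
  have a2 : inner ℝ (J (-h) x) x = inner ℝ (J h x) (J (-h) x)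
      - h * inner ℝ (A ⟨_, h1⟩) (J (-h) x) := by
    have := congrArg (inner ℝ (J (-h) x)) e1
    rw [inner_sub_right, real_inner_smul_right] at this
    rw [← this, real_inner_comm (J h x), real_inner_comm (A ⟨_, h1⟩)]
  rw [a1, a2, e3]
  ring

end IsResolvent

/-- A vector orthogonal to the domain has the form `x - A x` with `x` in the domain. Pairing it with
`x` gives `‖x‖² = 0`. -/
theorem IsSkewGenerator.dense [CompleteSpace H] (hA : IsSkewGenerator A) :
    Dense (A.domain : Set H) := by
  rw [Submodule.dense_iff_topologicalClosure_eq_top, Submodule.topologicalClosure_eq_top_iff,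
    Submodule.eq_bot_iff]
  intro z hz
  obtain ⟨x, rfl⟩ := hA.exists_sub_smul 1 one_ne_zero z
  have h1 := (Submodule.mem_orthogonal _ _).1 hz x x.2
  rw [one_smul, inner_sub_right, real_inner_comm, real_inner_comm (A x), hA.inner_self,
    sub_zero, inner_self_eq_zero] at h1
  have h2 : x = 0 := Subtype.ext h1
  simp [h2]

theorem IsResolvent.norm_apply_sub_le (hJ : IsResolvent A J) (hA : IsSkewGenerator A) {h : ℝ}
    (hh : h ≠ 0) (x : A.domain) : ‖J h x - x‖ ≤ |h| * ‖A x‖ := by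
  rw [← hJ.smul_apply hA hh, norm_smul, Real.norm_eq_abs]
  gcongr
  exact hJ.norm_le hA hh _

/-- Pointwise convergence of a bounded sequence of operators follows from that on a dense set. -/
theorem tendsto_apply_of_dense {E : Type*} [NormedAddCommGroup E] [NormedSpace ℝ E]
    {S : Set E} (hS : Dense S) {T : ℕ → E →L[ℝ] E} (hT : ∀ n x, ‖T n x‖ ≤ ‖x‖)
    (h : ∀ x ∈ S, Tendsto (fun n => T n x) atTop (𝓝 x)) (x : E) :
    Tendsto (fun n => T n x) atTop (𝓝 x) := by
  rw [Metric.tendsto_atTop]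
  intro ε hε
  obtain ⟨z, hz, hxz⟩ := hS.exists_dist_lt x (ε := ε / 3) (by positivity)
  obtain ⟨N, hN⟩ := Metric.tendsto_atTop.1 (h z hz) (ε / 3) (by positivity)
  refine ⟨N, fun n hn => ?_⟩
  have h1 := hN n hn
  have h2 := hT n (x - z)
  rw [dist_eq_norm] at *
  have : T n x - x = T n (x - z) + (T n z - z) - (x - z) := by rw [map_sub]; abel
  rw [this]
  calc _ ≤ ‖T n (x - z)‖ + ‖T n z - z‖ + ‖x - z‖ :=
        (norm_sub_le _ _).trans (by gcongr; exact norm_add_le _ _)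
    _ < ε := by linarith

theorem IsResolvent.tendsto [CompleteSpace H] (hJ : IsResolvent A J) (hA : IsSkewGenerator A)
    {h : ℕ → ℝ} (hh : ∀ n, h n ≠ 0) (h0 : Tendsto h atTop (𝓝 0)) (x : H) :
    Tendsto (fun n => J (h n) x) atTop (𝓝 x) := by
  refine tendsto_apply_of_dense hA.dense (T := fun n => J (h n))
    (fun n x => hJ.norm_le hA (hh n) x) (fun x hx => ?_) x
  rw [tendsto_iff_norm_sub_tendsto_zero]
  refine squeeze_zero (fun _ => norm_nonneg _)
    (fun n => hJ.norm_apply_sub_le hA (hh n) ⟨x, hx⟩) ?_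
  simpa using h0.abs.mul_const ‖A ⟨x, hx⟩‖

/-- The skew Yosida approximation `A (1 - h² A²)⁻¹`. -/
def yosida (J : ℝ → H →L[ℝ] H) (h : ℝ) : H →L[ℝ] H := (2 * h)⁻¹ • (J h - J (-h))

/-- This is why the symmetric difference is used: the usual approximation `(J h - 1) / h` is only
dissipative for `h > 0`, whereas a skew one has isometric exponentials in both time directions. -/
theorem inner_yosida (hJ : IsResolvent A J) (hA : IsSkewGenerator A) {h : ℝ} (hh : h ≠ 0)
    (x : H) : inner ℝ (yosida J h x) x = 0 := by
  simp [yosida, real_inner_smul_left, inner_sub_left, hJ.inner_eq hA hh]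

theorem commute_resolvent_yosida (hJ : IsResolvent A J) (hA : IsSkewGenerator A) {h m : ℝ}
    (hh : h ≠ 0) (hm : m ≠ 0) : Commute (J h) (yosida J m) :=
  ((hJ.commute hA hh hm).sub_right (hJ.commute hA hh (neg_ne_zero.2 hm))).smul_right _

theorem commute_yosida (hJ : IsResolvent A J) (hA : IsSkewGenerator A) {h m : ℝ}
    (hh : h ≠ 0) (hm : m ≠ 0) : Commute (yosida J h) (yosida J m) :=
  ((commute_resolvent_yosida hJ hA hh hm).sub_left
    (commute_resolvent_yosida hJ hA (neg_ne_zero.2 hh) hm)).smul_left _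

/-- On the domain the quotient by `h` disappears, leaving an average of two resolvents applied to `A
x`. Convergence to `A x` then follows from `J (±h) → 1`. -/
theorem yosida_apply (hJ : IsResolvent A J) (hA : IsSkewGenerator A) {h : ℝ} (hh : h ≠ 0)
    (x : A.domain) : yosida J h x = (2 : ℝ)⁻¹ • (J h (A x) + J (-h) (A x)) := by
  have h1 := hJ.smul_apply hA hh x
  have h2 := hJ.smul_apply hA (neg_ne_zero.2 hh) x
  have h3 : J h x - J (-h) x = h • (J h (A x) + J (-h) (A x)) := by
    rw [smul_add, h1, ← neg_neg h, neg_smul, neg_neg h, h2]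
    abel
  simp only [yosida, smul_apply, sub_apply]
  rw [h3, smul_smul]
  congr 1
  field_simp

theorem tendsto_yosida [CompleteSpace H] (hJ : IsResolvent A J) (hA : IsSkewGenerator A)
    {h : ℕ → ℝ} (hh : ∀ n, h n ≠ 0) (h0 : Tendsto h atTop (𝓝 0)) (x : A.domain) :
    Tendsto (fun n => yosida J (h n) x) atTop (𝓝 (A x)) := by
  simp only [fun n => yosida_apply hJ hA (hh n) x]
  have h1 := hJ.tendsto hA hh h0 (A x)
  have h2 := hJ.tendsto hA (fun n => neg_ne_zero.2 (hh n)) (by simpa using h0.neg) (A x)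
  have := (h1.add h2).const_smul (2 : ℝ)⁻¹
  rwa [← two_smul ℝ (A x), smul_smul, inv_mul_cancel₀ two_ne_zero, one_smul] at this

/-! ### Exponentials of bounded skew operators -/

section ExpSkew

variable [CompleteSpace H] {C : H →L[ℝ] H}

theorem hasDerivAt_exp_smul_apply (C : H →L[ℝ] H) (x : H) (t : ℝ) :
    HasDerivAt (fun t : ℝ => NormedSpace.exp (t • C) x) (NormedSpace.exp (t • C) (C x)) t :=
  (hasDerivAt_exp_smul_const C t).clm_apply (hasDerivAt_const t x) |>.congr_deriv (by simp)

theorem norm_exp_smul_apply (hC : ∀ x, inner ℝ (C x) x = 0) (t : ℝ) (x : H) :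
    ‖NormedSpace.exp (t • C) x‖ = ‖x‖ := by
  have hd : ∀ t : ℝ, HasDerivAt (fun t : ℝ => ‖NormedSpace.exp (t • C) x‖ ^ 2) 0 t := fun t => by
    have h1 : HasDerivAt (fun t : ℝ => NormedSpace.exp (t • C) x)
        (C (NormedSpace.exp (t • C) x)) t :=
      (hasDerivAt_exp_smul_const' C t).clm_apply (hasDerivAt_const t x) |>.congr_deriv (by simp)
    exact h1.norm_sq.congr_deriv (by rw [real_inner_comm, hC, mul_zero])
  have h2 := is_const_of_deriv_eq_zero (fun t => (hd t).differentiableAt)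
    (fun t => (hd t).deriv) t 0
  simpa using h2

theorem norm_exp_smul_apply_sub_le (hC : ∀ x, inner ℝ (C x) x = 0) (t s : ℝ) (x : H) :
    ‖NormedSpace.exp (t • C) x - NormedSpace.exp (s • C) x‖ ≤ ‖C x‖ * |t - s| :=
  convex_univ.norm_image_sub_le_of_norm_hasDerivWithin_le
    (f := fun t : ℝ => NormedSpace.exp (t • C) x)
    (fun r _ => (hasDerivAt_exp_smul_apply C x r).hasDerivWithinAt)
    (fun r _ => (norm_exp_smul_apply hC r _).le) (mem_univ s) (mem_univ t)

/-- Commutation gives `exp (t C) = exp (t C') exp (t (C - C'))`. The isometry `exp (t C')` factors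
out, and `C - C'` is again skew, so the orbit of `x` under its exponential moves at speed `‖(C - C')
x‖`. -/
theorem norm_exp_sub_exp_le {C' : H →L[ℝ] H} (hC : ∀ x, inner ℝ (C x) x = 0)
    (hC' : ∀ x, inner ℝ (C' x) x = 0) (hCC : Commute C C') (t : ℝ) (x : H) :
    ‖NormedSpace.exp (t • C) x - NormedSpace.exp (t • C') x‖ ≤ ‖C x - C' x‖ * |t| := by
  have h1 : NormedSpace.exp (t • C)
      = NormedSpace.exp (t • C') * NormedSpace.exp (t • (C - C')) := by
    let _ : NormedAlgebra ℚ (H →L[ℝ] H) := NormedAlgebra.restrictScalars ℚ ℝ _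
    rw [← NormedSpace.exp_add_of_commute]
    · congr 1
      rw [smul_sub]; abel
    · exact ((hCC.symm.sub_right (Commute.refl C')).smul_left t).smul_right t
  have h2 := norm_exp_smul_apply_sub_le (C := C - C')
    (fun x => by simp [inner_sub_left, hC, hC']) t 0 x
  rw [h1, mul_apply_eq_comp, ← map_sub, norm_exp_smul_apply hC']
  simpa using h2

end ExpSkew

end SkewGenerator

/-! ### The isometry group and the inhomogeneous equation -/

section Group

variable {H : Type*} [NormedAddCommGroup H] [InnerProductSpace ℝ H]

/-- `S` is the strongly continuous group of isometries generated by `A`. -/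
structure IsIsometryGroup (A : H →ₗ.[ℝ] H) (J : ℝ → H →L[ℝ] H) (S : ℝ → H →L[ℝ] H) : Prop where
  norm_apply (t : ℝ) (x : H) : ‖S t x‖ = ‖x‖
  zero_apply (x : H) : S 0 x = x
  apply_neg (t : ℝ) (x : H) : S t (S (-t) x) = x
  resolvent_apply (h : ℝ) (hh : h ≠ 0) (t : ℝ) (x : H) : J h (S t x) = S t (J h x)
  continuous (x : H) : Continuous fun t => S t x
  hasDerivAt (x : A.domain) (t : ℝ) : HasDerivAt (fun t => S t (x : H)) (S t (A x)) t

variable {A : H →ₗ.[ℝ] H} {J : ℝ → H →L[ℝ] H}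

theorem cauchySeq_of_dense {E : Type*} [NormedAddCommGroup E] [NormedSpace ℝ E]
    {S : Set E} (hS : Dense S) {T : ℕ → E →L[ℝ] E} (hT : ∀ n x, ‖T n x‖ ≤ ‖x‖)
    (h : ∀ x ∈ S, CauchySeq fun n => T n x) (x : E) : CauchySeq fun n => T n x := by
  rw [Metric.cauchySeq_iff]
  intro ε hε
  obtain ⟨z, hz, hxz⟩ := hS.exists_dist_lt x (ε := ε / 3) (by positivity)
  obtain ⟨N, hN⟩ := Metric.cauchySeq_iff.1 (h z hz) (ε / 3) (by positivity)
  refine ⟨N, fun m hm n hn => ?_⟩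
  have h1 := hN m hm n hn
  have h2 := hT n (x - z)
  have h3 := hT m (x - z)
  rw [dist_eq_norm] at *
  have : T m x - T n x = T m (x - z) + (T m z - T n z) - T n (x - z) := by
    rw [map_sub, map_sub]; abel
  rw [this]
  calc _ ≤ ‖T m (x - z)‖ + ‖T m z - T n z‖ + ‖T n (x - z)‖ :=
        (norm_sub_le _ _).trans (by gcongr; exact norm_add_le _ _)
    _ < ε := by linarith

theorem continuous_of_dense {E : Type*} [NormedAddCommGroup E] [NormedSpace ℝ E]
    {D : Set E} (hD : Dense D) {S : ℝ → E →L[ℝ] E} (hS : ∀ t x, ‖S t x‖ = ‖x‖)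
    (h : ∀ x ∈ D, Continuous fun t => S t x) (x : E) : Continuous fun t => S t x := by
  rw [Metric.continuous_iff]
  intro t ε hε
  obtain ⟨z, hz, hxz⟩ := hD.exists_dist_lt x (ε := ε / 3) (by positivity)
  obtain ⟨δ, hδ, hN⟩ := Metric.continuous_iff.1 (h z hz) t (ε / 3) (by positivity)
  refine ⟨δ, hδ, fun s hs => ?_⟩
  have h1 := hN s hs
  have h2 := hS s (x - z)
  have h3 := hS t (x - z)
  rw [dist_eq_norm] at *
  have : S s x - S t x = S s (x - z) + (S s z - S t z) - S t (x - z) := by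
    rw [map_sub, map_sub]; abel
  rw [this]
  calc _ ≤ ‖S s (x - z)‖ + ‖S s z - S t z‖ + ‖S t (x - z)‖ :=
        (norm_sub_le _ _).trans (by gcongr; exact norm_add_le _ _)
    _ < ε := by linarith

/-- Stone's theorem for skew-adjoint operators in a real Hilbert space. -/
theorem IsSkewGenerator.exists_isometryGroup [CompleteSpace H] (hA : IsSkewGenerator A)
    (hJ : IsResolvent A J) :
    ∃ S : ℝ → H →L[ℝ] H, IsIsometryGroup A J S := by
  let h : ℕ → ℝ := fun n => 1 / ((n : ℝ) + 1)
  have hh : ∀ n, h n ≠ 0 := fun n => by positivity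
  have h0 : Tendsto h atTop (𝓝 0) := tendsto_one_div_add_atTop_nhds_zero_nat
  let B : ℕ → H →L[ℝ] H := fun n => yosida J (h n)
  have hB : ∀ n x, inner ℝ (B n x) x = 0 := fun n => inner_yosida hJ hA (hh n)
  have hBt : ∀ x : A.domain, Tendsto (fun n => B n x) atTop (𝓝 (A x)) :=
    tendsto_yosida hJ hA hh h0
  let E : ℝ → ℕ → H →L[ℝ] H := fun t n => NormedSpace.exp (t • B n)
  have hE : ∀ t n x, ‖E t n x‖ = ‖x‖ := fun t n => norm_exp_smul_apply (hB n) t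
  -- On the domain, the difference of two exponentials is at most `|t| ‖B m x - B n x‖`, which is
  -- Cauchy; the isometry property extends this to all `x` by density.
  have hEc : ∀ t x, CauchySeq fun n => E t n x := fun t =>
    cauchySeq_of_dense hA.dense (fun n x => (hE t n x).le) fun x hx => by
      have hc := (hBt ⟨x, hx⟩).cauchySeq
      rw [Metric.cauchySeq_iff] at hc ⊢
      intro ε hε
      -- The `+ 1` keeps the denominator positive at `t = 0`.
      obtain ⟨N, hN⟩ := hc (ε / (|t| + 1)) (by positivity)
      refine ⟨N, fun m hm n hn => ?_⟩
      have h1 := hN m hm n hn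
      rw [dist_eq_norm, lt_div_iff₀ (by positivity)] at h1
      have h2 := norm_exp_sub_exp_le (hB m) (hB n) (commute_yosida hJ hA (hh m) (hh n)) t x
      rw [dist_eq_norm]
      refine h2.trans_lt (lt_of_le_of_lt ?_ h1)
      gcongr
      linarith
  have hEl : ∀ t x, ∃ y, Tendsto (fun n => E t n x) atTop (𝓝 y) := fun t x =>
    cauchySeq_tendsto_of_complete (hEc t x)
  choose S₀ hS₀ using hEl
  -- The pointwise limit is a bounded operator by Banach–Steinhaus.
  let S : ℝ → H →L[ℝ] H := fun t =>
    continuousLinearMapOfTendsto (E t) (f := S₀ t) (tendsto_pi_nhds.2 (hS₀ t))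
  have hS : ∀ t x, Tendsto (fun n => E t n x) atTop (𝓝 (S t x)) := hS₀
  have hSn : ∀ t x, ‖S t x‖ = ‖x‖ := fun t x =>
    tendsto_nhds_unique (hS t x).norm (by simp only [hE]; exact tendsto_const_nhds)
  have hSc : ∀ x, Continuous fun t => S t x := by
    refine continuous_of_dense hA.dense hSn fun x hx => ?_
    have hl : ∀ t s, dist (S t x) (S s x) ≤ ‖A ⟨x, hx⟩‖ * dist t s := fun t s => by
      refine le_of_tendsto_of_tendsto' ((hS t x).dist (hS s x))
        ((hBt ⟨x, hx⟩).norm.mul_const (dist t s)) fun n => ?_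
      rw [dist_eq_norm, Real.dist_eq]
      exact norm_exp_smul_apply_sub_le (hB n) t s x
    exact (LipschitzWith.of_dist_le_mul (K := ‖A ⟨x, hx⟩‖₊) hl).continuous
  -- The `E t n` are isometries, so the vector may vary with `n` in the limit.
  have hEt : ∀ t {y : ℕ → H} {z : H}, Tendsto y atTop (𝓝 z) →
      Tendsto (fun n => E t n (y n)) atTop (𝓝 (S t z)) := fun t y z hy => by
    have h1 : Tendsto (fun n => E t n (y n - z)) atTop (𝓝 0) := by
      rw [tendsto_zero_iff_norm_tendsto_zero]
      simp only [hE]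
      exact tendsto_iff_norm_sub_tendsto_zero.1 hy
    simpa using h1.add (hS t z)
  refine ⟨S, hSn, fun x => ?_, fun t x => ?_, fun m hm t x => ?_, hSc, fun x t => ?_⟩
  · refine tendsto_nhds_unique (hS 0 x) ?_
    simp only [E, zero_smul, NormedSpace.exp_zero]
    exact tendsto_const_nhds
  · have h1 := hEt t (hS (-t) x)
    refine tendsto_nhds_unique h1 ?_
    have : ∀ n, E t n (E (-t) n x) = x := fun n => by
      let _ : NormedAlgebra ℚ (H →L[ℝ] H) := NormedAlgebra.restrictScalars ℚ ℝ _
      have : E t n * E (-t) n = 1 := by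
        simp only [E, neg_smul]
        rw [← NormedSpace.exp_add_of_commute (Commute.refl _).neg_right, add_neg_cancel,
          NormedSpace.exp_zero]
      rw [← mul_apply_eq_comp, this]; rfl
    simp only [this]
    exact tendsto_const_nhds
  · refine tendsto_nhds_unique (((J m).continuous.tendsto _).comp (hS t x)) ?_
    have : ∀ n, J m (E t n x) = E t n (J m x) := fun n => by
      let _ : NormedAlgebra ℚ (H →L[ℝ] H) := NormedAlgebra.restrictScalars ℚ ℝ _
      exact congrArg (fun T : H →L[ℝ] H => T x)
        ((commute_resolvent_yosida hJ hA hm (hh n)).smul_right t).exp_right.eq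
    simp only [Function.comp_def, this]
    exact hS t _
  -- Derivatives need not survive pointwise limits, so the limit is taken in the integrated
  -- equation. The integrands are dominated by a bound for the convergent sequence `‖B n x‖`.
  · have hi : ∀ t, S t x = x + ∫ r in (0 : ℝ)..t, S r (A x) := fun t => by
      have hn : ∀ n, E t n x = x + ∫ r in (0 : ℝ)..t, E r n (B n x) := fun n => by
        have hc : Continuous fun r => E r n (B n x) := continuous_iff_continuousAt.2 fun r =>
          (hasDerivAt_exp_smul_apply (B n) (B n x) r).continuousAt
        rw [intervalIntegral.integral_eq_sub_of_hasDerivAt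
          (fun r _ => hasDerivAt_exp_smul_apply (B n) x r) (hc.intervalIntegrable _ _)]
        simp [E]
      refine tendsto_nhds_unique (hS t x) ?_
      simp only [hn]
      refine tendsto_const_nhds.add ?_
      obtain ⟨M, hM⟩ := (hBt x).norm.bddAbove_range
      refine intervalIntegral.tendsto_integral_filter_of_dominated_convergence (fun _ => M)
        (Eventually.of_forall fun n => ?_) (Eventually.of_forall fun n => ?_)
        intervalIntegrable_const (Eventually.of_forall fun r _ => hEt r (hBt x))
      · exact (continuous_iff_continuousAt.2 fun r =>
          (hasDerivAt_exp_smul_apply (B n) (B n x) r).continuousAt).aestronglyMeasurable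
      · refine Eventually.of_forall fun r _ => ?_
        rw [hE]
        exact hM ⟨n, rfl⟩
    have : (fun t => S t (x : H)) = fun t => (x : H) + ∫ r in (0 : ℝ)..t, S r (A x) := funext hi
    rw [this]
    exact ((hSc (A x)).integral_hasStrictDerivAt 0 t).hasDerivAt.const_add _

theorem IsIsometryGroup.continuous_apply {S : ℝ → H →L[ℝ] H} (hS : IsIsometryGroup A J S)
    {y : ℝ → H} {t : ℝ} (hy : ContinuousAt y t) : ContinuousAt (fun t => S t (y t)) t := by
  have h1 : Tendsto (fun s => S s (y s - y t)) (𝓝 t) (𝓝 0) := by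
    rw [tendsto_zero_iff_norm_tendsto_zero]
    simp only [hS.norm_apply]
    exact tendsto_iff_norm_sub_tendsto_zero.1 hy
  have := h1.add ((hS.continuous (y t)).tendsto t)
  simpa [ContinuousAt] using this

/-- The scalar factor vanishes at `t`, so the difference quotient is `g` itself and continuity of
`g` suffices. -/
theorem hasDerivAt_sub_smul {E : Type*} [NormedAddCommGroup E] [NormedSpace ℝ E] {g : ℝ → E}
    {t : ℝ} (hg : ContinuousAt g t) : HasDerivAt (fun r => (r - t) • g r) (g t) t := by
  rw [hasDerivAt_iff_tendsto_slope]
  refine (hg.tendsto.mono_left inf_le_left).congr' ?_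
  filter_upwards [self_mem_nhdsWithin] with r hr
  have : r - t ≠ 0 := sub_ne_zero.2 hr
  simp [slope, smul_smul, this]

/-- `S` is differentiable only along fixed vectors of the domain. Hence `y r` is split into `y t`,
handled by the generator, and `(r - t)` times the slope of `y`, for which strong continuity is
enough. Only `y t` has to lie in the domain. -/
theorem IsIsometryGroup.hasDerivAt_apply {S : ℝ → H →L[ℝ] H} (hS : IsIsometryGroup A J S)
    {y : ℝ → H} {y' : H} {t : ℝ} (hy : HasDerivAt y y' t) (hd : y t ∈ A.domain) :
    HasDerivAt (fun t => S t (y t)) (S t (A ⟨y t, hd⟩) + S t y') t := by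
  have h1 := hS.hasDerivAt ⟨y t, hd⟩ t
  have h2 := hasDerivAt_sub_smul
    (hS.continuous_apply (continuousAt_dslope_same.2 hy.differentiableAt))
  rw [dslope_same, hy.deriv] at h2
  convert h1.add h2 using 1
  ext r
  simp only [Pi.add_apply]
  rw [← map_smul, ← map_add, sub_smul_dslope, add_sub_cancel]

/-- The inhomogeneous evolution equation `U' = A U + F` with a skew-adjoint operator `A` and a
continuously differentiable right-hand side has a classical solution. -/
theorem IsSkewGenerator.exists_solution [CompleteSpace H] (hA : IsSkewGenerator A) {F F' : ℝ → H}
    (hF : ∀ t, HasDerivAt F (F' t) t) (hF' : Continuous F') (U₀ : A.domain) :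
    ∃ U : ℝ → A.domain, Continuous (fun t => A (U t)) ∧
      (∀ t, HasDerivAt (fun t => (U t : H)) (A (U t) + F t) t) ∧ U 0 = U₀ := by
  obtain ⟨J, hJ⟩ := hA.exists_resolvent
  obtain ⟨S, hS⟩ := hA.exists_isometryGroup hJ
  have h1 : (1 : ℝ) ≠ 0 := one_ne_zero
  have hFc : Continuous F := continuous_iff_continuousAt.2 fun t => (hF t).continuousAt
  have hAJ : ∀ x, A ⟨J 1 x, (hJ 1 h1 x).1⟩ = J 1 x - x := fun x => by
    have := (hJ 1 h1 x).2
    rw [one_smul, sub_eq_iff_eq_add, ← sub_eq_iff_eq_add'] at this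
    exact this.symm
  -- Formally, `v = U - U'` satisfies `v' = A v + F - F'` and `v 0 = U₀ - A U₀ - F 0`, so Duhamel
  -- gives `v t = S t (y t)`. Moreover `(1 - A) U = v + F`, so `U = J 1 (v + F)`: the resolvent
  -- supplies the regularity that `v` itself lacks.
  let p : ℝ → H := fun s => S (-s) (F s - F' s)
  have hp : Continuous p := continuous_iff_continuousAt.2 fun s => by
    have h2 : ContinuousAt (fun r => S r (F (-r) - F' (-r))) (-s) :=
      hS.continuous_apply (((hFc.sub hF').comp continuous_neg).continuousAt)
    have h3 := h2.comp (f := fun s : ℝ => -s) (x := s) continuous_neg.continuousAt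
    simpa only [Function.comp_def, neg_neg] using h3
  let y₀ : H := (U₀ : H) - A U₀ - F 0
  let y : ℝ → H := fun t => y₀ + ∫ s in (0 : ℝ)..t, p s
  have hy : ∀ t, HasDerivAt y (p t) t := fun t =>
    (hp.integral_hasStrictDerivAt 0 t).hasDerivAt.const_add _
  let z : ℝ → H := fun t => S t (y t) + F t
  have hz : Continuous z := (continuous_iff_continuousAt.2 fun t =>
    hS.continuous_apply (hy t).continuousAt).add hFc
  refine ⟨fun t => ⟨J 1 (z t), (hJ 1 h1 _).1⟩, ?_, fun t => ?_, ?_⟩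
  · simp only [hAJ]
    exact ((J 1).continuous.comp hz).sub hz
  -- Since `J 1` commutes with `S`, `U t = S t (J 1 (y t)) + J 1 (F t)`, and `J 1 (y t)` lies in the
  -- domain, so the product rule applies.
  · have h2 : HasDerivAt (fun t => J 1 (y t)) (J 1 (p t)) t :=
      (J 1).hasFDerivAt.comp_hasDerivAt t (hy t)
    have h3 : HasDerivAt (fun t => J 1 (F t)) (J 1 (F' t)) t :=
      (J 1).hasFDerivAt.comp_hasDerivAt t (hF t)
    have h4 := (hS.hasDerivAt_apply h2 (hJ 1 h1 _).1).add h3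
    convert h4 using 1
    · ext t
      simp only [z, map_add, hS.resolvent_apply 1 h1, Pi.add_apply]
    · rw [hAJ, hAJ, ← hS.resolvent_apply 1 h1 t (p t), hS.apply_neg, map_sub (S t),
        ← hS.resolvent_apply 1 h1]
      simp only [z, map_add, map_sub]
      abel
  · apply Subtype.ext
    have h2 := hJ.apply_sub hA h1 U₀
    simp only [z, y, y₀, intervalIntegral.integral_same, add_zero, hS.zero_apply, sub_add_cancel]
    simpa using h2

/-- A curve that starts at `0` and is orthogonal to its derivative vanishes. -/
theorem eqOn_of_hasDerivAt_of_inner_eq_zero {Z Z' : ℝ → H} (hc : ContinuousOn Z (Ici 0))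
    (hd : ∀ t > 0, HasDerivAt Z (Z' t) t) (hi : ∀ t > 0, inner ℝ (Z' t) (Z t) = 0)
    (h0 : Z 0 = 0) {t : ℝ} (ht : 0 ≤ t) : Z t = 0 := by
  rcases ht.eq_or_lt with rfl | ht
  · exact h0
  have hd2 : ∀ s ∈ Ioo 0 t, HasDerivAt (fun s => ‖Z s‖ ^ 2) 0 s := fun s hs =>
    (hd s hs.1).norm_sq.congr_deriv (by rw [real_inner_comm, hi s hs.1, mul_zero])
  have hc2 : ContinuousOn (fun s => ‖Z s‖ ^ 2) (Icc 0 t) :=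
    ((hc.mono Icc_subset_Ici_self).norm).pow 2
  obtain ⟨c, hcm, h⟩ := exists_hasDerivAt_eq_slope (fun s => ‖Z s‖ ^ 2) (fun _ => 0) ht hc2 hd2
  simp only [h0] at h
  have : ‖Z t‖ ^ 2 = 0 := by
    have := (eq_div_iff (sub_ne_zero.2 ht.ne')).1 h
    simpa using this.symm
  simpa using this

end Group

/-! ### Integration by parts, traces and natural boundary conditions in `H¹(0, L)` -/

section Sobolev

variable {L : ℝ}

theorem L2.intervalIntegrable (hL : 0 < L) (g : L2 L) : IntervalIntegrable g volume 0 L := by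
  rw [intervalIntegrable_iff_integrableOn_Ioo_of_le hL.le]
  exact g.integrable

/-- The primitive of `g` with value `c` at `0`. -/
def primitive (c : ℝ) (g : L2 L) (x : ℝ) : ℝ := c + ∫ t in (0 : ℝ)..x, g t

theorem primitive_zero_right (c : ℝ) (g : L2 L) : primitive c g 0 = c := by simp [primitive]

theorem absolutelyContinuousOnInterval_primitive (hL : 0 < L) (c : ℝ) (g : L2 L) :
    AbsolutelyContinuousOnInterval (primitive c g) 0 L := by
  have h1 : AbsolutelyContinuousOnInterval (fun _ : ℝ => c) 0 L :=
    ((contDiff_const (n := 1)).contDiffOn (s := uIcc 0 L)).absolutelyContinuousOnInterval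
  exact h1.add
    ((L2.intervalIntegrable hL g).absolutelyContinuousOnInterval_intervalIntegral (by simp))

theorem deriv_primitive (hL : 0 < L) (c : ℝ) (g : L2 L) :
    deriv (primitive c g) =ᵐ[volume.restrict (Ioo 0 L)] g := by
  rw [EventuallyEq, ae_restrict_iff' measurableSet_Ioo]
  filter_upwards [(L2.intervalIntegrable hL g).ae_hasDerivAt_integral] with x hx hx'
  refine ((hx ?_ 0 (by simp)).const_add c).deriv
  rw [uIcc_of_le hL.le]
  exact Ioo_subset_Icc_self hx'

theorem continuousOn_primitive (hL : 0 < L) (c : ℝ) (g : L2 L) :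
    ContinuousOn (primitive c g) (Icc 0 L) := by
  have := (absolutelyContinuousOnInterval_primitive hL c g).continuousOn
  rwa [uIcc_of_le hL.le] at this

theorem integral_mul_deriv_add {F G f g : ℝ → ℝ} (hL : 0 < L)
    (hF : AbsolutelyContinuousOnInterval F 0 L) (hG : AbsolutelyContinuousOnInterval G 0 L)
    (hf : deriv F =ᵐ[volume.restrict (Ioo 0 L)] f) (hg : deriv G =ᵐ[volume.restrict (Ioo 0 L)] g) :
    (∫ x in Ioo 0 L, F x * g x) + ∫ x in Ioo 0 L, f x * G x = F L * G L - F 0 * G 0 := by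
  have h := hF.integral_mul_deriv_eq_deriv_mul hG
  rw [intervalIntegral.integral_of_le hL.le, intervalIntegral.integral_of_le hL.le,
    integral_Ioc_eq_integral_Ioo, integral_Ioc_eq_integral_Ioo] at h
  have h1 : ∫ x in Ioo 0 L, F x * g x = ∫ x in Ioo 0 L, F x * deriv G x :=
    integral_congr_ae (by filter_upwards [hg] with x hx; rw [hx])
  have h2 : ∫ x in Ioo 0 L, f x * G x = ∫ x in Ioo 0 L, deriv F x * G x :=
    integral_congr_ae (by filter_upwards [hf] with x hx; rw [hx])
  rw [h1, h2, h]
  ring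

theorem IsTestFunction.absolutelyContinuousOnInterval {I : Set ℝ} {φ : ℝ → ℝ}
    (hφ : IsTestFunction I φ) : AbsolutelyContinuousOnInterval φ 0 L :=
  ((hφ.contDiff.of_le (by exact_mod_cast le_top)).contDiffOn
    (s := uIcc 0 L)).absolutelyContinuousOnInterval

theorem IsTestFunction.apply_zero {φ : ℝ → ℝ} (hφ : IsTestFunction (Ioo 0 L) φ) : φ 0 = 0 :=
  image_eq_zero_of_notMem_tsupport fun hx => lt_irrefl _ (hφ.tsupport_subset hx).1

theorem IsTestFunction.apply_right {φ : ℝ → ℝ} (hφ : IsTestFunction (Ioo 0 L) φ) : φ L = 0 :=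
  image_eq_zero_of_notMem_tsupport fun hx => lt_irrefl _ (hφ.tsupport_subset hx).2

/-- A function with an absolutely continuous representative is weakly differentiable. -/
theorem isWeakDeriv_of_absolutelyContinuous (hL : 0 < L) {f g : L2 L} {F : ℝ → ℝ}
    (hF : AbsolutelyContinuousOnInterval F 0 L) (hf : f =ᵐ[volume.restrict (Ioo 0 L)] F)
    (hg : deriv F =ᵐ[volume.restrict (Ioo 0 L)] g) : IsWeakDeriv f g := by
  intro φ hφ
  have h := integral_mul_deriv_add hL hF hφ.absolutelyContinuousOnInterval hg (ae_eq_refl _)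
  rw [hφ.apply_zero, hφ.apply_right] at h
  have h1 : ∫ x in Ioo 0 L, f x * deriv φ x = ∫ x in Ioo 0 L, F x * deriv φ x :=
    integral_congr_ae (by filter_upwards [hf] with x hx; rw [hx])
  rw [h1]
  linarith

theorem memLp_of_continuousOn {F : ℝ → ℝ} (hF : ContinuousOn F (Icc 0 L)) :
    MemLp F 2 (volume.restrict (Ioo 0 L)) := by
  obtain ⟨C, hC⟩ := isCompact_Icc.exists_bound_of_continuousOn hF
  refine MemLp.of_bound ((hF.mono Ioo_subset_Icc_self).aestronglyMeasurable measurableSet_Ioo) C ?_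
  rw [ae_restrict_iff' measurableSet_Ioo]
  exact Eventually.of_forall fun x hx => hC x (Ioo_subset_Icc_self hx)

/-- The function is the primitive of `g` vanishing at `0`. It serves to rebuild `w`, `ξ`, `s` from
limits of their derivatives and, with `g = 1`, to test the boundary value at `L`. -/
theorem exists_isWeakDeriv (hL : 0 < L) (g : L2 L) :
    ∃ f : H1star L, IsWeakDeriv (f : L2 L) g ∧ HasTrace (f : L2 L) L (∫ x in Ioo 0 L, g x) := by
  have hc := continuousOn_primitive hL 0 g
  have hm := memLp_of_continuousOn hc
  have hw := isWeakDeriv_of_absolutelyContinuous hL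
    (absolutelyContinuousOnInterval_primitive hL 0 g) hm.coeFn_toLp (deriv_primitive hL 0 g)
  refine ⟨⟨hm.toLp, ⟨g, hw⟩, ⟨_, hc, hm.coeFn_toLp, primitive_zero_right 0 g⟩⟩, hw,
    ⟨_, hc, hm.coeFn_toLp, ?_⟩⟩
  rw [primitive, zero_add, intervalIntegral.integral_of_le hL.le, integral_Ioc_eq_integral_Ioo]

theorem HasTrace.trace_eq (hL : 0 < L) {f : L2 L} {a c : ℝ} (ha : a ∈ Icc 0 L)
    (h : HasTrace f a c) : trace a f = c := by
  have h' : ∃ c, HasTrace f a c := ⟨c, h⟩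
  rw [trace, dif_pos h']
  exact h'.choose_spec.unique hL ha h

theorem trace_eq_of_ae_eq (hL : 0 < L) {f : L2 L} {F : ℝ → ℝ} (hF : ContinuousOn F (Icc 0 L))
    (hf : f =ᵐ[volume.restrict (Ioo 0 L)] F) {a : ℝ} (ha : a ∈ Icc 0 L) : trace a f = F a :=
  HasTrace.trace_eq hL ha ⟨F, hF, hf, rfl⟩

theorem ae_eq_primitive_D (hL : 0 < L) {f : L2 L} (hf : f ∈ H1 L) :
    f =ᵐ[volume.restrict (Ioo 0 L)] primitive (trace 0 f) (D f) := by
  obtain ⟨c, hc⟩ := (isWeakDeriv_D hf).ae_eq_primitive hL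
  have h := trace_eq_of_ae_eq hL (continuousOn_primitive hL c (D f)) hc ⟨le_rfl, hL.le⟩
  rw [primitive_zero_right] at h
  rw [h]
  exact hc

theorem inner_eq_integral (f g : L2 L) : inner ℝ f g = ∫ x in Ioo 0 L, f x * g x := by
  rw [MeasureTheory.L2.inner_def]
  simp [mul_comm]

/-- Integration by parts in `H¹(0, L)`. -/
theorem inner_D_add_D_inner (hL : 0 < L) {f g : L2 L} (hf : f ∈ H1 L) (hg : g ∈ H1 L) :
    inner ℝ f (D g) + inner ℝ (D f) g = trace L f * trace L g - trace 0 f * trace 0 g := by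
  have h0 : (0 : ℝ) ∈ Icc 0 L := ⟨le_rfl, hL.le⟩
  have h1 : L ∈ Icc 0 L := ⟨hL.le, le_rfl⟩
  have af := ae_eq_primitive_D hL hf
  have ag := ae_eq_primitive_D hL hg
  have h := integral_mul_deriv_add hL
    (absolutelyContinuousOnInterval_primitive hL (trace 0 f) (D f))
    (absolutelyContinuousOnInterval_primitive hL (trace 0 g) (D g))
    (deriv_primitive hL _ _) (deriv_primitive hL _ _)
  rw [← trace_eq_of_ae_eq hL (continuousOn_primitive hL _ _) af h1,
    ← trace_eq_of_ae_eq hL (continuousOn_primitive hL _ _) ag h1,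
    ← trace_eq_of_ae_eq hL (continuousOn_primitive hL _ _) af h0,
    ← trace_eq_of_ae_eq hL (continuousOn_primitive hL _ _) ag h0] at h
  rw [← h, inner_eq_integral, inner_eq_integral]
  congr 1
  · exact integral_congr_ae (by filter_upwards [af] with x hx; rw [hx])
  · exact integral_congr_ae (by filter_upwards [ag] with x hx; rw [hx])

theorem trace_zero_of_mem_H1star (hL : 0 < L) {f : L2 L} (hf : f ∈ H1star L) : trace 0 f = 0 :=
  hf.2.trace_eq hL ⟨le_rfl, hL.le⟩

/-- Cauchy–Schwarz against the indicator of `(0, x)`, whose norm is `√x ≤ √L`. -/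
theorem abs_integral_le (g : L2 L) {x : ℝ} (hx : x ∈ Icc 0 L) :
    |∫ t in (0 : ℝ)..x, g t| ≤ √L * ‖g‖ := by
  have hfin : volume.restrict (Ioo 0 L) (Ioo 0 x) ≠ ⊤ := measure_ne_top _ _
  have h1 := MeasureTheory.L2.inner_indicatorConstLp_one (𝕜 := ℝ)
    (measurableSet_Ioo (a := (0 : ℝ)) (b := x)) hfin g
  have h2 := abs_real_inner_le_norm (indicatorConstLp 2 (measurableSet_Ioo (a := (0 : ℝ)) (b := x))
    hfin (1 : ℝ)) g
  rw [h1, norm_indicatorConstLp (by norm_num) (by norm_num),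
    Measure.restrict_restrict measurableSet_Ioo,
    inter_eq_left.2 (Ioo_subset_Ioo_right hx.2)] at h2
  rw [intervalIntegral.integral_of_le hx.1, integral_Ioc_eq_integral_Ioo]
  refine h2.trans ?_
  gcongr
  rw [measureReal_restrict_apply measurableSet_Ioo, inter_eq_left.2 (Ioo_subset_Ioo_right hx.2)]
  simp [Real.sqrt_eq_rpow, hx.1]
  exact Real.rpow_le_rpow hx.1 hx.2 (by norm_num)

theorem abs_trace_le (hL : 0 < L) {f : L2 L} (hf : f ∈ H1star L) {x : ℝ} (hx : x ∈ Icc 0 L) :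
    |trace x f| ≤ √L * ‖D f‖ := by
  have h := trace_eq_of_ae_eq hL (continuousOn_primitive hL _ _) (ae_eq_primitive_D hL hf.1) hx
  rw [h, primitive, trace_zero_of_mem_H1star hL hf, zero_add]
  exact abs_integral_le _ hx

/-- The Poincaré inequality in `H¹_*(0, L)`. -/
theorem norm_le_norm_D (hL : 0 < L) {f : L2 L} (hf : f ∈ H1star L) : ‖f‖ ≤ L * ‖D f‖ := by
  have h : ∀ᵐ x ∂volume.restrict (Ioo 0 L), ‖f x‖ ≤ √L * ‖D f‖ := by
    filter_upwards [ae_eq_primitive_D hL hf.1, ae_restrict_mem measurableSet_Ioo] with x hx hm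
    rw [hx, primitive, trace_zero_of_mem_H1star hL hf, zero_add]
    exact abs_integral_le _ (Ioo_subset_Icc_self hm)
  refine (Lp.norm_le_of_ae_bound (by positivity) h).trans (le_of_eq ?_)
  have h1 : measureUnivNNReal (volume.restrict (Ioo 0 L)) = L.toNNReal := by
    simp [measureUnivNNReal, ENNReal.ofReal, ENNReal.toNNReal_coe]
  have h2 : (L.toNNReal : ℝ) ^ (ENNReal.toReal 2)⁻¹ = √L := by
    rw [Real.coe_toNNReal _ hL.le, Real.sqrt_eq_rpow]
    norm_num
  rw [h1, h2, ← mul_assoc, Real.mul_self_sqrt hL.le]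

/-- A weak form contains both the equation and its natural boundary condition. Test functions
supported inside `(0, L)` give `p' = q`; integration by parts then reduces the identity to `(p(L) +
c) φ(L) = 0`. -/
theorem isWeakDeriv_and_hasTrace_of_inner (hL : 0 < L) {p q : L2 L} {c : ℝ}
    (h : ∀ φ ∈ H1star L, inner ℝ p (D φ) + inner ℝ q φ + c * trace L φ = 0) :
    IsWeakDeriv p q ∧ HasTrace p L (-c) := by
  have hLm : L ∈ Icc 0 L := ⟨hL.le, le_rfl⟩
  have hw : IsWeakDeriv p q := by
    intro φ hφ
    have hc : ContinuousOn φ (Icc 0 L) := hφ.contDiff.continuous.continuousOn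
    have hm := memLp_of_continuousOn hc
    have hm' := memLp_of_continuousOn (hφ.deriv.contDiff.continuous.continuousOn (s := Icc 0 L))
    have hd : IsWeakDeriv (hm.toLp : L2 L) hm'.toLp := isWeakDeriv_of_absolutelyContinuous hL
      hφ.absolutelyContinuousOnInterval hm.coeFn_toLp hm'.coeFn_toLp.symm
    have h1 := h hm.toLp ⟨⟨_, hd⟩, ⟨φ, hc, hm.coeFn_toLp, hφ.apply_zero⟩⟩
    rw [trace_eq_of_ae_eq hL hc hm.coeFn_toLp hLm, hφ.apply_right, hd.D_eq, inner_eq_integral,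
      inner_eq_integral] at h1
    have e1 : ∫ x in Ioo 0 L, p x * (hm'.toLp : L2 L) x = ∫ x in Ioo 0 L, p x * deriv φ x :=
      integral_congr_ae (by filter_upwards [hm'.coeFn_toLp] with x hx; rw [hx])
    have e2 : ∫ x in Ioo 0 L, q x * (hm.toLp : L2 L) x = ∫ x in Ioo 0 L, q x * φ x :=
      integral_congr_ae (by filter_upwards [hm.coeFn_toLp] with x hx; rw [hx])
    rw [e1, e2] at h1
    linarith
  refine ⟨hw, ?_⟩
  have hp : p ∈ H1 L := ⟨q, hw⟩
  have hm := memLp_of_continuousOn (L := L) (continuousOn_const (c := (1 : ℝ)))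
  -- Here `φ(x) = x`, so that `φ(L) = L ≠ 0`.
  obtain ⟨φ, -, hφ⟩ := exists_isWeakDeriv hL hm.toLp
  have e : ∫ x in Ioo 0 L, (hm.toLp : L2 L) x = L := by
    rw [integral_congr_ae hm.coeFn_toLp]
    simp [hL.le]
  rw [e] at hφ
  have h1 := h φ φ.2
  have h2 := inner_D_add_D_inner hL hp φ.2.1
  rw [hw.D_eq, trace_zero_of_mem_H1star hL φ.2, hφ.trace_eq hL hLm] at h2
  rw [hφ.trace_eq hL hLm] at h1
  have h3 : (trace L p + c) * L = 0 := by linarith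
  have h4 : trace L p = -c := by
    rcases mul_eq_zero.1 h3 with h3 | h3
    · linarith
    · exact absurd h3 hL.ne'
  exact h4 ▸ hasTrace_trace hp L

end Sobolev

/-! ### The energy space: bounded coordinates and completeness -/

namespace State

variable {P : Beam}

theorem inner_eq (U V : State P) : inner ℝ U V =
    3 * P.ρ₁ * inner ℝ U.Ψ₁ V.Ψ₁ + 3 * P.ρ₂ * inner ℝ U.Ψ₂ V.Ψ₂ + P.ρ₂ * inner ℝ U.Ψ₃ V.Ψ₃
    + 3 * P.b * inner ℝ (D (U.ξ : L2 P.L)) (D (V.ξ : L2 P.L))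
    + P.b * inner ℝ (D (U.s : L2 P.L)) (D (V.s : L2 P.L))
    + P.γ * inner ℝ (U.s : L2 P.L) (V.s : L2 P.L)
    + 3 * P.k * inner ℝ U.shear V.shear
    + 3 * P.k * (U.Ψ₄ * V.Ψ₄) + 3 * P.b * (U.Ψ₅ * V.Ψ₅) + P.b * (U.Ψ₆ * V.Ψ₆) := rfl

theorem norm_sq_eq (U : State P) : ‖U‖ ^ 2 =
    3 * P.ρ₁ * ‖U.Ψ₁‖ ^ 2 + 3 * P.ρ₂ * ‖U.Ψ₂‖ ^ 2 + P.ρ₂ * ‖U.Ψ₃‖ ^ 2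
    + 3 * P.b * ‖D (U.ξ : L2 P.L)‖ ^ 2 + P.b * ‖D (U.s : L2 P.L)‖ ^ 2
    + P.γ * ‖(U.s : L2 P.L)‖ ^ 2 + 3 * P.k * ‖U.shear‖ ^ 2
    + 3 * P.k * ‖U.Ψ₄‖ ^ 2 + 3 * P.b * ‖U.Ψ₅‖ ^ 2 + P.b * ‖U.Ψ₆‖ ^ 2 := by
  rw [← real_inner_self_eq_norm_sq, inner_eq]
  simp only [real_inner_self_eq_norm_sq, Real.norm_eq_abs, sq_abs]
  ring

theorem exists_bound_of_sq_le {E : Type*} [NormedAddCommGroup E] {f : State P → E} {c : ℝ}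
    (hc : 0 < c) (h : ∀ U, c * ‖f U‖ ^ 2 ≤ ‖U‖ ^ 2) : ∀ U, ‖f U‖ ≤ (√c)⁻¹ * ‖U‖ := by
  intro U
  rw [← div_eq_inv_mul, le_div_iff₀ (Real.sqrt_pos.2 hc)]
  refine abs_le_of_sq_le_sq' ?_ (norm_nonneg _) |>.2
  rw [mul_pow, Real.sq_sqrt hc.le, mul_comm]
  exact h U

/-- The terms of the energy norm are bounded by the energy norm. -/
theorem terms_le (U : State P) :
    3 * P.ρ₁ * ‖U.Ψ₁‖ ^ 2 ≤ ‖U‖ ^ 2 ∧ 3 * P.ρ₂ * ‖U.Ψ₂‖ ^ 2 ≤ ‖U‖ ^ 2 ∧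
    P.ρ₂ * ‖U.Ψ₃‖ ^ 2 ≤ ‖U‖ ^ 2 ∧ 3 * P.b * ‖D (U.ξ : L2 P.L)‖ ^ 2 ≤ ‖U‖ ^ 2 ∧
    P.b * ‖D (U.s : L2 P.L)‖ ^ 2 ≤ ‖U‖ ^ 2 ∧ 3 * P.k * ‖U.shear‖ ^ 2 ≤ ‖U‖ ^ 2 ∧
    3 * P.k * ‖U.Ψ₄‖ ^ 2 ≤ ‖U‖ ^ 2 ∧ 3 * P.b * ‖U.Ψ₅‖ ^ 2 ≤ ‖U‖ ^ 2 ∧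
    P.b * ‖U.Ψ₆‖ ^ 2 ≤ ‖U‖ ^ 2 := by
  have := P.ρ₁_pos; have := P.ρ₂_pos; have := P.k_pos; have := P.b_pos; have := P.γ_pos
  have a1 : 0 ≤ 3 * P.ρ₁ * ‖U.Ψ₁‖ ^ 2 := by positivity
  have a2 : 0 ≤ 3 * P.ρ₂ * ‖U.Ψ₂‖ ^ 2 := by positivity
  have a3 : 0 ≤ P.ρ₂ * ‖U.Ψ₃‖ ^ 2 := by positivity
  have a4 : 0 ≤ 3 * P.b * ‖D (U.ξ : L2 P.L)‖ ^ 2 := by positivity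
  have a5 : 0 ≤ P.b * ‖D (U.s : L2 P.L)‖ ^ 2 := by positivity
  have a6 : 0 ≤ P.γ * ‖(U.s : L2 P.L)‖ ^ 2 := by positivity
  have a7 : 0 ≤ 3 * P.k * ‖U.shear‖ ^ 2 := by positivity
  have a8 : 0 ≤ 3 * P.k * ‖U.Ψ₄‖ ^ 2 := by positivity
  have a9 : 0 ≤ 3 * P.b * ‖U.Ψ₅‖ ^ 2 := by positivity
  have a10 : 0 ≤ P.b * ‖U.Ψ₆‖ ^ 2 := by positivity
  have h := norm_sq_eq U
  refine ⟨?_, ?_, ?_, ?_, ?_, ?_, ?_, ?_, ?_⟩ <;> linarith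

theorem isBounded_Ψ₁ : IsBoundedLinearMap ℝ (Ψ₁ : State P → L2 P.L) :=
  IsLinearMap.with_bound ⟨add_Ψ₁, smul_Ψ₁⟩ _
    (exists_bound_of_sq_le (mul_pos three_pos P.ρ₁_pos) fun U => U.terms_le.1)

theorem isBounded_Ψ₂ : IsBoundedLinearMap ℝ (Ψ₂ : State P → L2 P.L) :=
  IsLinearMap.with_bound ⟨add_Ψ₂, smul_Ψ₂⟩ _
    (exists_bound_of_sq_le (mul_pos three_pos P.ρ₂_pos) fun U => U.terms_le.2.1)

theorem isBounded_Ψ₃ : IsBoundedLinearMap ℝ (Ψ₃ : State P → L2 P.L) :=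
  IsLinearMap.with_bound ⟨add_Ψ₃, smul_Ψ₃⟩ _
    (exists_bound_of_sq_le P.ρ₂_pos fun U => U.terms_le.2.2.1)

theorem isBounded_D_ξ : IsBoundedLinearMap ℝ fun U : State P => D (U.ξ : L2 P.L) :=
  IsLinearMap.with_bound ⟨fun U V => D_add_coe U.ξ V.ξ, fun c U => D_smul_coe c U.ξ⟩ _
    (exists_bound_of_sq_le (mul_pos three_pos P.b_pos) fun U => U.terms_le.2.2.2.1)

theorem isBounded_D_s : IsBoundedLinearMap ℝ fun U : State P => D (U.s : L2 P.L) :=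
  IsLinearMap.with_bound ⟨fun U V => D_add_coe U.s V.s, fun c U => D_smul_coe c U.s⟩ _
    (exists_bound_of_sq_le P.b_pos fun U => U.terms_le.2.2.2.2.1)

theorem isBounded_shear : IsBoundedLinearMap ℝ (shear : State P → L2 P.L) :=
  IsLinearMap.with_bound ⟨shear_add, shear_smul⟩ _
    (exists_bound_of_sq_le (mul_pos three_pos P.k_pos) fun U => U.terms_le.2.2.2.2.2.1)

theorem isBounded_Ψ₄ : IsBoundedLinearMap ℝ (Ψ₄ : State P → ℝ) :=
  IsLinearMap.with_bound ⟨add_Ψ₄, smul_Ψ₄⟩ _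
    (exists_bound_of_sq_le (mul_pos three_pos P.k_pos) fun U => U.terms_le.2.2.2.2.2.2.1)

theorem isBounded_Ψ₅ : IsBoundedLinearMap ℝ (Ψ₅ : State P → ℝ) :=
  IsLinearMap.with_bound ⟨add_Ψ₅, smul_Ψ₅⟩ _
    (exists_bound_of_sq_le (mul_pos three_pos P.b_pos) fun U => U.terms_le.2.2.2.2.2.2.2.1)

theorem isBounded_Ψ₆ : IsBoundedLinearMap ℝ (Ψ₆ : State P → ℝ) :=
  IsLinearMap.with_bound ⟨add_Ψ₆, smul_Ψ₆⟩ _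
    (exists_bound_of_sq_le P.b_pos fun U => U.terms_le.2.2.2.2.2.2.2.2)

/-- By Poincaré, control of the derivative is enough. -/
theorem isBounded_coe {v : State P → H1star P.L} (hadd : ∀ U V, v (U + V) = v U + v V)
    (hsmul : ∀ (c : ℝ) U, v (c • U) = c • v U)
    (hD : IsBoundedLinearMap ℝ fun U => D (v U : L2 P.L)) :
    IsBoundedLinearMap ℝ fun U => (v U : L2 P.L) := by
  obtain ⟨M, -, hM⟩ := hD.bound
  refine IsLinearMap.with_bound ⟨fun U V => by rw [hadd]; rfl, fun c U => by rw [hsmul]; rfl⟩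
    (P.L * M) fun U => ?_
  refine (norm_le_norm_D P.L_pos (v U).2).trans ?_
  rw [mul_assoc]
  exact mul_le_mul_of_nonneg_left (hM U) P.L_pos.le

theorem isBounded_trace {v : State P → H1star P.L} (hadd : ∀ U V, v (U + V) = v U + v V)
    (hsmul : ∀ (c : ℝ) U, v (c • U) = c • v U)
    (hD : IsBoundedLinearMap ℝ fun U => D (v U : L2 P.L)) :
    IsBoundedLinearMap ℝ fun U => trace P.L (v U : L2 P.L) := by
  obtain ⟨M, -, hM⟩ := hD.bound
  have hm : P.L ∈ Icc 0 P.L := ⟨P.L_pos.le, le_rfl⟩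
  refine IsLinearMap.with_bound ⟨fun U V => ?_, fun c U => ?_⟩ (√P.L * M) fun U => ?_
  · rw [hadd]
    exact trace_add P.L_pos hm (v U).2.1 (v V).2.1
  · rw [hsmul]
    exact trace_smul P.L_pos hm c (v U).2.1
  · refine (abs_trace_le P.L_pos (v U).2 hm).trans ?_
    rw [mul_assoc]
    exact mul_le_mul_of_nonneg_left (hM U) (Real.sqrt_nonneg _)

theorem isBounded_ξ : IsBoundedLinearMap ℝ fun U : State P => (U.ξ : L2 P.L) :=
  isBounded_coe add_ξ smul_ξ isBounded_D_ξ

theorem isBounded_s : IsBoundedLinearMap ℝ fun U : State P => (U.s : L2 P.L) :=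
  isBounded_coe add_s smul_s isBounded_D_s

/-- The energy contains `w_x` only through the shear; `ξ` and `s`, already bounded, are subtracted.
-/
theorem isBounded_D_w : IsBoundedLinearMap ℝ fun U : State P => D (U.w : L2 P.L) := by
  convert (isBounded_shear (P := P)).sub (isBounded_ξ.add isBounded_s) using 1
  ext1 U
  simp only [shear]
  abel

theorem isBounded_w : IsBoundedLinearMap ℝ fun U : State P => (U.w : L2 P.L) :=
  isBounded_coe add_w smul_w isBounded_D_w

/-- Along a Cauchy sequence `w_x`, `ξ_x`, `s_x` and all the `Ψ` coordinates converge. The limit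
state takes the primitives of the first three; by Poincaré `ξ` and `s` converge too, hence so does
the shear, and every term of the energy of the difference tends to `0`. -/
instance : CompleteSpace (State P) := by
  refine Metric.complete_of_cauchySeq_tendsto fun u hu => ?_
  have hL := P.L_pos
  have lim : ∀ {E : Type} [NormedAddCommGroup E] [NormedSpace ℝ E] [CompleteSpace E]
      {f : State P → E}, IsBoundedLinearMap ℝ f → ∃ a, Tendsto (fun n => f (u n)) atTop (𝓝 a) :=
    fun hf => cauchySeq_tendsto_of_complete
      (hf.toContinuousLinearMap.uniformContinuous.comp_cauchySeq hu)
  obtain ⟨a, ha⟩ := lim isBounded_D_w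
  obtain ⟨a1, h1⟩ := lim isBounded_Ψ₁
  obtain ⟨b, hb⟩ := lim isBounded_D_ξ
  obtain ⟨a2, h2⟩ := lim isBounded_Ψ₂
  obtain ⟨c, hc⟩ := lim isBounded_D_s
  obtain ⟨a3, h3⟩ := lim isBounded_Ψ₃
  obtain ⟨a4, h4⟩ := lim isBounded_Ψ₄
  obtain ⟨a5, h5⟩ := lim isBounded_Ψ₅
  obtain ⟨a6, h6⟩ := lim isBounded_Ψ₆
  obtain ⟨w, hw, -⟩ := exists_isWeakDeriv hL a
  obtain ⟨ξ, hξ, -⟩ := exists_isWeakDeriv hL b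
  obtain ⟨s, hs, -⟩ := exists_isWeakDeriv hL c
  rw [← hw.D_eq] at ha
  rw [← hξ.D_eq] at hb
  rw [← hs.D_eq] at hc
  let V : State P := ⟨w, a1, ξ, a2, s, a3, a4, a5, a6⟩
  have zero : ∀ {E : Type} [NormedAddCommGroup E] [NormedSpace ℝ E] {f : State P → E},
      IsBoundedLinearMap ℝ f → Tendsto (fun n => f (u n)) atTop (𝓝 (f V)) →
      Tendsto (fun n => ‖f (u n - V)‖ ^ 2) atTop (𝓝 0) := fun {E _ _ f} hf h => by
    have := (tendsto_iff_norm_sub_tendsto_zero.1 h).pow 2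
    have e : ∀ U V, f (U - V) = f U - f V := fun U V => hf.toIsLinearMap.map_sub U V
    simpa [e] using this
  have coe : ∀ {v : State P → H1star P.L}, (∀ U V, v (U - V) = v U - v V) →
      Tendsto (fun n => D (v (u n) : L2 P.L)) atTop (𝓝 (D (v V : L2 P.L))) →
      Tendsto (fun n => (v (u n) : L2 P.L)) atTop (𝓝 (v V)) := fun {v} hv h => by
    rw [tendsto_iff_norm_sub_tendsto_zero] at h ⊢
    have e : ∀ n, ‖(v (u n) : L2 P.L) - v V‖
        ≤ P.L * ‖D (v (u n) : L2 P.L) - D (v V : L2 P.L)‖ := fun n => by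
      have h1 := norm_le_norm_D hL (v (u n) - v V).2
      have h2 := D_add_coe (v (u n)) (-v V)
      have h3 := D_smul_coe (-1) (v V)
      rw [neg_one_smul, neg_one_smul] at h3
      rw [Submodule.coe_neg, h3, ← sub_eq_add_neg, ← sub_eq_add_neg] at h2
      rwa [Submodule.coe_sub, h2] at h1
    exact squeeze_zero (fun _ => norm_nonneg _) e (by simpa using h.const_mul P.L)
  have hξt := coe (v := State.ξ) (fun _ _ => rfl) hb
  have hst := coe (v := State.s) (fun _ _ => rfl) hc
  have hsh : Tendsto (fun n => (u n).shear) atTop (𝓝 V.shear) := (ha.add hξt).add hst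
  refine ⟨V, ?_⟩
  rw [tendsto_iff_norm_sub_tendsto_zero]
  have key : Tendsto (fun n => ‖u n - V‖ ^ 2) atTop (𝓝 0) := by
    simp only [norm_sq_eq]
    have := (((((((((zero isBounded_Ψ₁ h1).const_mul (3 * P.ρ₁)).add
      ((zero isBounded_Ψ₂ h2).const_mul (3 * P.ρ₂))).add
      ((zero isBounded_Ψ₃ h3).const_mul P.ρ₂)).add
      ((zero isBounded_D_ξ hb).const_mul (3 * P.b))).add
      ((zero isBounded_D_s hc).const_mul P.b)).add
      ((zero isBounded_s hst).const_mul P.γ)).add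
      ((zero isBounded_shear hsh).const_mul (3 * P.k))).add
      ((zero isBounded_Ψ₄ h4).const_mul (3 * P.k))).add
      ((zero isBounded_Ψ₅ h5).const_mul (3 * P.b)) |>.add
      ((zero isBounded_Ψ₆ h6).const_mul P.b)
    simpa using this
  have := key.sqrt
  simpa using this

/-- The states with `(w, ξ, s) = h (Ψ₁, Ψ₂, Ψ₃)` and `(w, ξ, s)(L) = h (Ψ₄, Ψ₅, Ψ₆)`. -/
def velocityGraph (P : Beam) (h : ℝ) : Submodule ℝ (State P) where
  carrier := {U | ((U.w : L2 P.L) = h • U.Ψ₁ ∧ (U.ξ : L2 P.L) = h • U.Ψ₂ ∧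
    (U.s : L2 P.L) = h • U.Ψ₃) ∧ trace P.L (U.w : L2 P.L) = h * U.Ψ₄ ∧
    trace P.L (U.ξ : L2 P.L) = h * U.Ψ₅ ∧ trace P.L (U.s : L2 P.L) = h * U.Ψ₆}
  add_mem' := by
    rintro U V ⟨⟨a1, a2, a3⟩, a4, a5, a6⟩ ⟨⟨b1, b2, b3⟩, b4, b5, b6⟩
    have hw := (isBounded_trace add_w smul_w isBounded_D_w).toIsLinearMap.map_add U V
    have hξ := (isBounded_trace add_ξ smul_ξ isBounded_D_ξ).toIsLinearMap.map_add U V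
    have hs := (isBounded_trace add_s smul_s isBounded_D_s).toIsLinearMap.map_add U V
    refine ⟨⟨?_, ?_, ?_⟩, ?_, ?_, ?_⟩
    · simp [a1, b1]
    · simp [a2, b2]
    · simp [a3, b3]
    · rw [hw, a4, b4, add_Ψ₄, mul_add]
    · rw [hξ, a5, b5, add_Ψ₅, mul_add]
    · rw [hs, a6, b6, add_Ψ₆, mul_add]
  zero_mem' := by
    have hw := (isBounded_trace add_w smul_w isBounded_D_w).toIsLinearMap.map_zero (M := State P)
    have hξ := (isBounded_trace add_ξ smul_ξ isBounded_D_ξ).toIsLinearMap.map_zero (M := State P)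
    have hs := (isBounded_trace add_s smul_s isBounded_D_s).toIsLinearMap.map_zero (M := State P)
    refine ⟨⟨?_, ?_, ?_⟩, ?_, ?_, ?_⟩
    · simp
    · simp
    · simp
    · rw [hw]; simp
    · rw [hξ]; simp
    · rw [hs]; simp
  smul_mem' := by
    rintro c U ⟨⟨a1, a2, a3⟩, a4, a5, a6⟩
    have hw := (isBounded_trace add_w smul_w isBounded_D_w).toIsLinearMap.map_smul c U
    have hξ := (isBounded_trace add_ξ smul_ξ isBounded_D_ξ).toIsLinearMap.map_smul c U
    have hs := (isBounded_trace add_s smul_s isBounded_D_s).toIsLinearMap.map_smul c U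
    refine ⟨⟨?_, ?_, ?_⟩, ?_, ?_, ?_⟩
    · simp [a1, smul_comm c h]
    · simp [a2, smul_comm c h]
    · simp [a3, smul_comm c h]
    · rw [hw, a4, smul_Ψ₄, smul_eq_mul]; ring
    · rw [hξ, a5, smul_Ψ₅, smul_eq_mul]; ring
    · rw [hs, a6, smul_Ψ₆, smul_eq_mul]; ring

theorem isClosed_velocityGraph (h : ℝ) : IsClosed (velocityGraph P h : Set (State P)) := by
  refine IsClosed.inter (IsClosed.inter ?_ (IsClosed.inter ?_ ?_))
    (IsClosed.inter ?_ (IsClosed.inter ?_ ?_))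
  · exact isClosed_eq isBounded_w.continuous (isBounded_Ψ₁.continuous.const_smul h)
  · exact isClosed_eq isBounded_ξ.continuous (isBounded_Ψ₂.continuous.const_smul h)
  · exact isClosed_eq isBounded_s.continuous (isBounded_Ψ₃.continuous.const_smul h)
  · exact isClosed_eq (isBounded_trace add_w smul_w isBounded_D_w).continuous
      (isBounded_Ψ₄.continuous.const_mul h)
  · exact isClosed_eq (isBounded_trace add_ξ smul_ξ isBounded_D_ξ).continuous
      (isBounded_Ψ₅.continuous.const_mul h)
  · exact isClosed_eq (isBounded_trace add_s smul_s isBounded_D_s).continuous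
      (isBounded_Ψ₆.continuous.const_mul h)

end State

theorem D_zero {L : ℝ} : D (0 : L2 L) = 0 := IsWeakDeriv.zero.D_eq

theorem trace_zero {L : ℝ} (hL : 0 < L) : trace L (0 : L2 L) = 0 :=
  (HasTrace.zero L).trace_eq hL ⟨hL.le, le_rfl⟩

namespace State

variable {P : Beam}

theorem trace_shear {U : State P} (hU : U ∈ domain P) : trace P.L U.shear =
    trace P.L (D (U.w : L2 P.L)) + trace P.L (U.ξ : L2 P.L) + trace P.L (U.s : L2 P.L) := by
  have hm : P.L ∈ Icc 0 P.L := ⟨P.L_pos.le, le_rfl⟩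
  have hw := D_mem_H1 hU.1.1
  rw [shear, trace_add P.L_pos hm (add_mem hw U.ξ.2.1) U.s.2.1, trace_add P.L_pos hm hw U.ξ.2.1]

end State

/-! ### The beam operator is skew and satisfies the range condition -/

namespace Beam

variable {P : Beam}

section Components

variable (U : P.operator.domain)

theorem operator_ξ : ((P.operator U).ξ : L2 P.L) = (U : State P).Ψ₂ := rfl

theorem operator_s : ((P.operator U).s : L2 P.L) = (U : State P).Ψ₃ := rfl

theorem operator_Ψ₁ : (P.operator U).Ψ₁ = (1 / P.ρ₁) • (P.k • D (U : State P).shear) := rfl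

theorem operator_Ψ₂ : (P.operator U).Ψ₂ = (1 / P.ρ₂) •
    (P.b • D (D ((U : State P).ξ : L2 P.L)) - P.k • (U : State P).shear) := rfl

theorem operator_Ψ₃ : (P.operator U).Ψ₃ = (1 / P.ρ₂) •
    (P.b • D (D ((U : State P).s : L2 P.L)) - (3 * P.k) • (U : State P).shear
      - P.γ • ((U : State P).s : L2 P.L)) := rfl

theorem operator_Ψ₄ : (P.operator U).Ψ₄ = -trace P.L (U : State P).shear := by
  rw [State.trace_shear U.2]; rfl

theorem operator_Ψ₅ : (P.operator U).Ψ₅ = -trace P.L (D ((U : State P).ξ : L2 P.L)) := rfl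

theorem operator_Ψ₆ : (P.operator U).Ψ₆ = -trace P.L (D ((U : State P).s : L2 P.L)) := rfl

theorem operator_shear : (P.operator U).shear
    = D (U : State P).Ψ₁ + (U : State P).Ψ₂ + (U : State P).Ψ₃ := rfl

end Components

/-- Integrate by parts the pairs (shear, `Ψ₁`), (`ξ_x`, `Ψ₂`), (`s_x`, `Ψ₃`). The terms at `0`
vanish because the velocities do, those at `L` cancel against the last three coordinates of `A U`,
and the zeroth-order terms cancel in pairs. -/
theorem operator_inner_self (U : P.operator.domain) :
    inner ℝ (P.operator U) (U : State P) = 0 := by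
  have hL := P.L_pos
  have hρ₁ := P.ρ₁_pos.ne'
  have hρ₂ := P.ρ₂_pos.ne'
  have hm : P.L ∈ Icc 0 P.L := ⟨hL.le, le_rfl⟩
  have hσ := State.shear_mem_H1 U.2
  rw [State.inner_eq, operator_ξ, operator_s, operator_Ψ₁, operator_Ψ₂, operator_Ψ₃,
    operator_Ψ₄, operator_Ψ₅, operator_Ψ₆, operator_shear]
  obtain ⟨U, ⟨hw, hξ, hs⟩, ⟨h1, h2, h3⟩, h4, h5, h6⟩ := U
  dsimp only at hσ ⊢
  have i1 := inner_D_add_D_inner hL hσ h1.1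
  have i2 := inner_D_add_D_inner hL (D_mem_H1 hξ) h2.1
  have i3 := inner_D_add_D_inner hL (D_mem_H1 hs) h3.1
  rw [trace_zero_of_mem_H1star hL h1, h4.trace_eq hL hm, real_inner_comm (D U.Ψ₁)] at i1
  rw [trace_zero_of_mem_H1star hL h2, h5.trace_eq hL hm, real_inner_comm (D U.Ψ₂)] at i2
  rw [trace_zero_of_mem_H1star hL h3, h6.trace_eq hL hm, real_inner_comm (D U.Ψ₃)] at i3
  simp only [inner_add_left, inner_sub_left, real_inner_smul_left]
  rw [real_inner_comm U.Ψ₂ U.shear, real_inner_comm U.Ψ₃ U.shear,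
    real_inner_comm U.Ψ₃ (U.s : L2 P.L)]
  field_simp
  linear_combination 3 * P.k * i1 + 3 * P.b * i2 + P.b * i3

/-- The position equations say that `U`, with the positions of `F` subtracted, lies in
`velocityGraph P h`. The velocity equations, in weak form, say that a certain vector `T` is
orthogonal to that subspace. An orthogonal projection meets both requirements, whatever the sign of
`h`. -/
theorem exists_sub_smul_operator {h : ℝ} (hh : h ≠ 0) (F : State P) :
    ∃ U : P.operator.domain, (U : State P) - h • P.operator U = F := by
  have hL := P.L_pos
  have hρ₁ := P.ρ₁_pos.ne'
  have hρ₂ := P.ρ₂_pos.ne'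
  have hk := P.k_pos.ne'
  have hb := P.b_pos.ne'
  have hm : P.L ∈ Icc 0 P.L := ⟨hL.le, le_rfl⟩
  have : CompleteSpace (State.velocityGraph P h) :=
    (State.isClosed_velocityGraph h).completeSpace_coe
  -- The signs are such that subtracting the projected vector from `X` yields the positions of `U`
  -- and the velocities of `U - F`. That difference is `T = -Z`.
  obtain ⟨X, ⟨⟨x1, x2, x3⟩, x4, x5, x6⟩, Z, hZ, e⟩ :=
    (State.velocityGraph P h).exists_add_mem_mem_orthogonal
      (⟨-F.w, F.Ψ₁, -F.ξ, F.Ψ₂, -F.s, F.Ψ₃, F.Ψ₄, F.Ψ₅, F.Ψ₆⟩ : State P)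
  let U : State P :=
    ⟨X.w + F.w, X.Ψ₁, X.ξ + F.ξ, X.Ψ₂, X.s + F.s, X.Ψ₃, X.Ψ₄, X.Ψ₅, X.Ψ₆⟩
  let T : State P := ⟨X.w + F.w, X.Ψ₁ - F.Ψ₁, X.ξ + F.ξ, X.Ψ₂ - F.Ψ₂, X.s + F.s, X.Ψ₃ - F.Ψ₃,
    X.Ψ₄ - F.Ψ₄, X.Ψ₅ - F.Ψ₅, X.Ψ₆ - F.Ψ₆⟩
  have hT : ∀ Y ∈ State.velocityGraph P h, inner ℝ T Y = 0 := fun Y hY => by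
    have e1 : T = -Z := by
      rw [eq_sub_iff_add_eq'.2 e.symm, neg_sub]
      ext1
      · exact (sub_neg_eq_add _ _).symm
      · rfl
      · exact (sub_neg_eq_add _ _).symm
      · rfl
      · exact (sub_neg_eq_add _ _).symm
      all_goals rfl
    rw [e1, inner_neg_left, real_inner_comm, hZ Y hY, neg_zero]
  have hTs : T.shear = U.shear := rfl
  -- Orthogonality to the graph element built from `φ` in one of the three components is the weak
  -- form of that component's equation, including its boundary condition at `L`.
  obtain ⟨c1, d1⟩ := isWeakDeriv_and_hasTrace_of_inner hL (p := h • U.shear)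
    (q := (P.ρ₁ / P.k) • T.Ψ₁) (c := T.Ψ₄) fun φ hφ => by
      have := hT ⟨h • ⟨φ, hφ⟩, φ, 0, 0, 0, 0, trace P.L φ, 0, 0⟩ ⟨⟨rfl, by simp, by simp⟩,
        trace_smul hL hm h hφ.1, by simp [trace_zero hL], by simp [trace_zero hL]⟩
      rw [State.inner_eq, hTs] at this
      simp only [State.shear, Submodule.coe_smul, Submodule.coe_zero, D_smul h hφ.1, D_zero,
        inner_zero_right, add_zero, mul_zero, real_inner_smul_right] at this
      simp only [State.shear, real_inner_smul_left]
      field_simp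
      linear_combination this / 3
  obtain ⟨c2, d2⟩ := isWeakDeriv_and_hasTrace_of_inner hL (p := h • D (U.ξ : L2 P.L))
    (q := (P.ρ₂ / P.b) • T.Ψ₂ + (P.k * h / P.b) • U.shear) (c := T.Ψ₅) fun φ hφ => by
      have := hT ⟨0, 0, h • ⟨φ, hφ⟩, φ, 0, 0, 0, trace P.L φ, 0⟩ ⟨⟨by simp, rfl, by simp⟩,
        by simp [trace_zero hL], trace_smul hL hm h hφ.1, by simp [trace_zero hL]⟩
      rw [State.inner_eq, hTs] at this
      simp only [State.shear, Submodule.coe_smul, Submodule.coe_zero, D_smul h hφ.1, D_zero,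
        inner_zero_right, add_zero, zero_add, mul_zero, real_inner_smul_right] at this
      simp only [State.shear, real_inner_smul_left, inner_add_left] at this ⊢
      field_simp
      linear_combination this / 3
  obtain ⟨c3, d3⟩ := isWeakDeriv_and_hasTrace_of_inner hL (p := h • D (U.s : L2 P.L))
    (q := (P.ρ₂ / P.b) • T.Ψ₃ + (3 * P.k * h / P.b) • U.shear
      + (P.γ * h / P.b) • (U.s : L2 P.L)) (c := T.Ψ₆) fun φ hφ => by
      have := hT ⟨0, 0, 0, 0, h • ⟨φ, hφ⟩, φ, 0, 0, trace P.L φ⟩ ⟨⟨by simp, by simp, rfl⟩,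
        by simp [trace_zero hL], by simp [trace_zero hL], trace_smul hL hm h hφ.1⟩
      rw [State.inner_eq, hTs] at this
      simp only [State.shear, Submodule.coe_smul, Submodule.coe_zero, D_smul h hφ.1, D_zero,
        inner_zero_right, add_zero, zero_add, mul_zero, real_inner_smul_right] at this
      simp only [State.shear, real_inner_smul_left, inner_add_left] at this ⊢
      field_simp
      linear_combination this
  have unscale : ∀ {p q : L2 P.L} {c : ℝ}, IsWeakDeriv (h • p) q → HasTrace (h • p) P.L (-c) →
      p ∈ H1 P.L ∧ h • D p = q ∧ h * trace P.L p = -c := fun {p q c} hw ht => by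
    have h1 : p ∈ H1 P.L := ⟨h⁻¹ • q, by simpa [smul_smul, hh] using hw.smul h⁻¹⟩
    refine ⟨h1, ?_, ?_⟩
    · rw [← D_smul h h1, hw.D_eq]
    · rw [← trace_smul hL hm h h1, ht.trace_eq hL hm]
  obtain ⟨m1, q1, r1⟩ := unscale c1 d1
  obtain ⟨m2, q2, r2⟩ := unscale c2 d2
  obtain ⟨m3, q3, r3⟩ := unscale c3 d3
  have mw : D (U.w : L2 P.L) ∈ H1 P.L := by
    have := sub_mem (sub_mem m1 U.s.2.1) U.ξ.2.1
    simpa [State.shear] using this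
  -- The velocities are `h⁻¹` times positions of `X`, hence inherit `H¹_*` regularity and the
  -- required values at `L`.
  have vel : ∀ {f : H1star P.L} {g : L2 P.L} {c : ℝ}, (f : L2 P.L) = h • g →
      trace P.L (f : L2 P.L) = h * c → g ∈ H1star P.L ∧ HasTrace g P.L c := fun {f g c} hf ht => by
    have hg : g = h⁻¹ • (f : L2 P.L) := by rw [hf, smul_smul, inv_mul_cancel₀ hh, one_smul]
    have hc : c = h⁻¹ * trace P.L (f : L2 P.L) := by rw [ht]; field_simp
    rw [hg, hc]
    exact ⟨Submodule.smul_mem _ _ f.2, (hasTrace_trace f.2.1 _).smul _⟩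
  obtain ⟨v1, y1⟩ := vel x1 x4
  obtain ⟨v2, y2⟩ := vel x2 x5
  obtain ⟨v3, y3⟩ := vel x3 x6
  have hU : U ∈ P.operator.domain :=
    ⟨⟨⟨_, mw, isWeakDeriv_D U.w.2.1⟩, ⟨_, m2, isWeakDeriv_D U.ξ.2.1⟩,
      ⟨_, m3, isWeakDeriv_D U.s.2.1⟩⟩, ⟨v1, v2, v3⟩, y1, y2, y3⟩
  refine ⟨⟨U, hU⟩, ?_⟩
  rw [sub_eq_iff_eq_add]
  ext1
  · apply Subtype.ext
    change (X.w : L2 P.L) + F.w = F.w + h • X.Ψ₁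
    rw [x1, add_comm]
  · rw [State.add_Ψ₁, State.smul_Ψ₁, operator_Ψ₁, smul_comm h, smul_comm h, q1]
    change X.Ψ₁ = F.Ψ₁ + (1 / P.ρ₁) • (P.k • ((P.ρ₁ / P.k) • (X.Ψ₁ - F.Ψ₁)))
    match_scalars <;> field_simp
    ring
  · apply Subtype.ext
    change (X.ξ : L2 P.L) + F.ξ = F.ξ + h • X.Ψ₂
    rw [x2, add_comm]
  · rw [State.add_Ψ₂, State.smul_Ψ₂, operator_Ψ₂, smul_comm h, smul_sub, smul_comm h, q2]
    change X.Ψ₂ = F.Ψ₂ + (1 / P.ρ₂) • (P.b • ((P.ρ₂ / P.b) • (X.Ψ₂ - F.Ψ₂) + _) - _)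
    match_scalars <;> field_simp <;> ring
  · apply Subtype.ext
    change (X.s : L2 P.L) + F.s = F.s + h • X.Ψ₃
    rw [x3, add_comm]
  · rw [State.add_Ψ₃, State.smul_Ψ₃, operator_Ψ₃, smul_comm h (1 / P.ρ₂), smul_sub h,
      smul_sub h, smul_comm h P.b, q3]
    change X.Ψ₃ = F.Ψ₃ + (1 / P.ρ₂) • (P.b • ((P.ρ₂ / P.b) • (X.Ψ₃ - F.Ψ₃) + _ + _) - _ - _)
    match_scalars <;> field_simp <;> ring
  · rw [State.add_Ψ₄, State.smul_Ψ₄, operator_Ψ₄, mul_neg, r1]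
    simp [T, U]
  · rw [State.add_Ψ₅, State.smul_Ψ₅, operator_Ψ₅, mul_neg, r2]
    simp [T, U]
  · rw [State.add_Ψ₆, State.smul_Ψ₆, operator_Ψ₆, mul_neg, r3]
    simp [T, U]

theorem isSkewGenerator_operator (P : Beam) : IsSkewGenerator P.operator :=
  ⟨operator_inner_self, fun _ hh F => exists_sub_smul_operator hh F⟩

end Beam

/-! ### The beam system as an evolution equation -/

variable {P : Beam}

/-- The boundary controls as a forcing term of the evolution equation in the phase space. -/
def forcing (P : Beam) (u₁ u₂ u₃ : ℝ → ℝ) (t : ℝ) : State P :=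
  ⟨0, 0, 0, 0, 0, 0, u₁ t, u₂ t, u₃ t⟩

theorem forcing_eq (u₁ u₂ u₃ : ℝ → ℝ) : forcing P u₁ u₂ u₃ = fun t =>
    u₁ t • (⟨0, 0, 0, 0, 0, 0, 1, 0, 0⟩ : State P) + u₂ t • ⟨0, 0, 0, 0, 0, 0, 0, 1, 0⟩
      + u₃ t • ⟨0, 0, 0, 0, 0, 0, 0, 0, 1⟩ := by
  ext t <;> simp [forcing]

theorem continuous_forcing {u₁ u₂ u₃ : ℝ → ℝ} (h₁ : Continuous u₁) (h₂ : Continuous u₂)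
    (h₃ : Continuous u₃) : Continuous (forcing P u₁ u₂ u₃) := by
  rw [forcing_eq]
  exact ((h₁.smul continuous_const).add (h₂.smul continuous_const)).add
    (h₃.smul continuous_const)

theorem hasDerivAt_forcing {u₁ u₂ u₃ u₁' u₂' u₃' : ℝ → ℝ} {t : ℝ} (h₁ : HasDerivAt u₁ (u₁' t) t)
    (h₂ : HasDerivAt u₂ (u₂' t) t) (h₃ : HasDerivAt u₃ (u₃' t) t) :
    HasDerivAt (forcing P u₁ u₂ u₃) (forcing P u₁' u₂' u₃' t) t := by
  rw [forcing_eq, forcing_eq]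
  exact ((h₁.smul_const _).add (h₂.smul_const _)).add (h₃.smul_const _)

theorem _root_.IsBoundedLinearMap.hasDerivAt_comp {E F : Type*} [NormedAddCommGroup E]
    [NormedSpace ℝ E] [NormedAddCommGroup F] [NormedSpace ℝ F] {f : E → F}
    (hf : IsBoundedLinearMap ℝ f) {U : ℝ → E} {U' : E} {t : ℝ} (h : HasDerivAt U U' t) :
    HasDerivAt (fun τ => f (U τ)) (f U') t :=
  hf.hasFDerivAt.comp_hasDerivAt t h

/-- Classical solutions of the evolution equation solve the beam system. -/
theorem solvesSystem_of_hasDerivAt {u₁ u₂ u₃ : ℝ → ℝ} {U₀ : State P} {U : ℝ → P.operator.domain}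
    (hU : ∀ t, HasDerivAt (fun t => (U t : State P)) (P.operator (U t) + forcing P u₁ u₂ u₃ t) t)
    (h0 : U 0 = U₀) : SolvesSystem P u₁ u₂ u₃ U₀ fun t => U t := by
  have hρ₁ := P.ρ₁_pos.ne'
  have hρ₂ := P.ρ₂_pos.ne'
  refine
    { w_t := fun t _ => ?_, ξ_t := fun t _ => ?_, s_t := fun t _ => ?_
      w_t_L := fun t _ => (U t).2.2.2.1
      ξ_t_L := fun t _ => (U t).2.2.2.2.1
      s_t_L := fun t _ => (U t).2.2.2.2.2
      eq_w := fun t _ => ⟨_, _, State.isBounded_Ψ₁.hasDerivAt_comp (hU t),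
        isWeakDeriv_D (State.shear_mem_H1 (U t).2), ?_⟩
      eq_ξ := fun t _ => ⟨_, _, State.isBounded_Ψ₂.hasDerivAt_comp (hU t),
        isWeakDeriv_D (D_mem_H1 (U t).2.1.2.1), ?_⟩
      eq_s := fun t _ => ⟨_, _, State.isBounded_Ψ₃.hasDerivAt_comp (hU t),
        isWeakDeriv_D (D_mem_H1 (U t).2.1.2.2), ?_⟩
      bc_zero := fun t _ => ⟨(U t : State P).w.2.2, (U t : State P).ξ.2.2, (U t : State P).s.2.2⟩
      bc_w := fun t _ => ⟨_, _, _, _, State.isBounded_Ψ₄.hasDerivAt_comp (hU t),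
        hasTrace_trace (D_mem_H1 (U t).2.1.1) _, hasTrace_trace (U t : State P).ξ.2.1 _,
        hasTrace_trace (U t : State P).s.2.1 _, ?_⟩
      bc_ξ := fun t _ => ⟨_, _, State.isBounded_Ψ₅.hasDerivAt_comp (hU t),
        hasTrace_trace (D_mem_H1 (U t).2.1.2.1) _, ?_⟩
      bc_s := fun t _ => ⟨_, _, State.isBounded_Ψ₆.hasDerivAt_comp (hU t),
        hasTrace_trace (D_mem_H1 (U t).2.1.2.2) _, ?_⟩
      init := h0 }
  · refine (State.isBounded_w.hasDerivAt_comp (hU t)).congr_deriv ?_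
    exact add_zero _
  · refine (State.isBounded_ξ.hasDerivAt_comp (hU t)).congr_deriv ?_
    exact add_zero _
  · refine (State.isBounded_s.hasDerivAt_comp (hU t)).congr_deriv ?_
    exact add_zero _
  · rw [State.add_Ψ₁, Beam.operator_Ψ₁]
    change P.ρ₁ • (_ + (0 : L2 P.L)) - _ = 0
    match_scalars
    field_simp
    ring
  · rw [State.add_Ψ₂, Beam.operator_Ψ₂]
    change P.ρ₂ • (_ + (0 : L2 P.L)) - _ + _ = 0
    match_scalars <;> field_simp
    all_goals ring
  · rw [State.add_Ψ₃, Beam.operator_Ψ₃]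
    change P.ρ₂ • (_ + (0 : L2 P.L)) - _ + _ + _ = 0
    match_scalars <;> field_simp <;> ring
  · rw [State.add_Ψ₄, Beam.operator_Ψ₄, State.trace_shear (U t).2]
    simp only [forcing]
    ring
  · rw [State.add_Ψ₅, Beam.operator_Ψ₅]
    simp only [forcing]
    ring
  · rw [State.add_Ψ₆, Beam.operator_Ψ₆]
    simp only [forcing]
    ring

/-- Differentiable solutions of the beam system solve the evolution equation. -/
theorem SolvesSystem.deriv_eq {u₁ u₂ u₃ : ℝ → ℝ} {U₀ : State P} {V : ℝ → State P}
    (hV : SolvesSystem P u₁ u₂ u₃ U₀ V) {t : ℝ} (ht : 0 < t) {V' : State P}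
    (hd : HasDerivAt V V' t) (hm : V t ∈ P.operator.domain) :
    V' = P.operator ⟨V t, hm⟩ + forcing P u₁ u₂ u₃ t := by
  have hρ₁ := P.ρ₁_pos.ne'
  have hρ₂ := P.ρ₂_pos.ne'
  have hLm : P.L ∈ Icc 0 P.L := ⟨P.L_pos.le, le_rfl⟩
  have solve : ∀ {ρ : ℝ} {x y : L2 P.L}, ρ ≠ 0 → ρ • x = y → x = (1 / ρ) • y := by
    rintro ρ x _ hρ rfl
    rw [smul_smul, one_div, inv_mul_cancel₀ hρ, one_smul]
  -- Coordinates are bounded, so each coordinate of `V'` is the derivative of that coordinate of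
  -- `V`; uniqueness of derivatives matches it with the one given by the system.
  ext1
  · apply Subtype.ext
    exact ((State.isBounded_w.hasDerivAt_comp hd).unique (hV.w_t t ht)).trans (add_zero _).symm
  · obtain ⟨wtt, σx, h1, h2, h3⟩ := hV.eq_w t ht
    rw [State.add_Ψ₁, Beam.operator_Ψ₁, h2.D_eq, (State.isBounded_Ψ₁.hasDerivAt_comp hd).unique h1]
    exact (solve hρ₁ (sub_eq_zero.1 h3)).trans (add_zero _).symm
  · apply Subtype.ext
    exact ((State.isBounded_ξ.hasDerivAt_comp hd).unique (hV.ξ_t t ht)).trans (add_zero _).symm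
  · obtain ⟨ξtt, ξxx, h1, h2, h3⟩ := hV.eq_ξ t ht
    rw [State.add_Ψ₂, Beam.operator_Ψ₂, h2.D_eq, (State.isBounded_Ψ₂.hasDerivAt_comp hd).unique h1]
    refine (solve hρ₂ ?_).trans (add_zero _).symm
    rw [← sub_eq_zero, ← h3]
    abel
  · apply Subtype.ext
    exact ((State.isBounded_s.hasDerivAt_comp hd).unique (hV.s_t t ht)).trans (add_zero _).symm
  · obtain ⟨stt, sxx, h1, h2, h3⟩ := hV.eq_s t ht
    rw [State.add_Ψ₃, Beam.operator_Ψ₃, h2.D_eq, (State.isBounded_Ψ₃.hasDerivAt_comp hd).unique h1]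
    refine (solve hρ₂ ?_).trans (add_zero _).symm
    rw [← sub_eq_zero, ← h3]
    abel
  · obtain ⟨wttL, wxL, ξL, sL, h1, h2, h3, h4, h5⟩ := hV.bc_w t ht
    rw [State.add_Ψ₄, Beam.operator_Ψ₄, State.trace_shear hm, h2.trace_eq P.L_pos hLm,
      h3.trace_eq P.L_pos hLm, h4.trace_eq P.L_pos hLm,
      (State.isBounded_Ψ₄.hasDerivAt_comp hd).unique h1]
    simp only [forcing, ← h5]
    ring
  · obtain ⟨ξttL, ξxL, h1, h2, h3⟩ := hV.bc_ξ t ht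
    rw [State.add_Ψ₅, Beam.operator_Ψ₅, h2.trace_eq P.L_pos hLm,
      (State.isBounded_Ψ₅.hasDerivAt_comp hd).unique h1]
    simp only [forcing, ← h3]
    ring
  · obtain ⟨sttL, sxL, h1, h2, h3⟩ := hV.bc_s t ht
    rw [State.add_Ψ₆, Beam.operator_Ψ₆, h2.trace_eq P.L_pos hLm,
      (State.isBounded_Ψ₆.hasDerivAt_comp hd).unique h1]
    simp only [forcing, ← h3]
    ring

/-- Differentiable solutions of the beam system are determined by the data. -/
theorem SolvesSystem.eqOn {u₁ u₂ u₃ : ℝ → ℝ} {U₀ : State P} {V W : ℝ → State P}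
    (hV : SolvesSystem P u₁ u₂ u₃ U₀ V) (hVc : ContinuousInDomain P.operator V)
    (hVd : ContDiffOn ℝ 1 V (Ici 0)) (hW : SolvesSystem P u₁ u₂ u₃ U₀ W)
    (hWc : ContinuousInDomain P.operator W) (hWd : ContDiffOn ℝ 1 W (Ici 0)) :
    EqOn V W (Ici 0) := by
  obtain ⟨mV, -⟩ := hVc
  obtain ⟨mW, -⟩ := hWc
  have diff : ∀ {X : ℝ → State P}, ContDiffOn ℝ 1 X (Ici 0) → ∀ t > 0,
      HasDerivAt X (deriv X t) t := fun hX t ht =>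
    ((hX.differentiableOn one_ne_zero).differentiableAt (Ici_mem_nhds ht)).hasDerivAt
  intro t ht
  rw [← sub_eq_zero]
  refine eqOn_of_hasDerivAt_of_inner_eq_zero (Z := fun t => V t - W t)
    (Z' := fun t => deriv V t - deriv W t) (hVd.continuousOn.sub hWd.continuousOn)
    (fun t ht => (diff hVd t ht).sub (diff hWd t ht)) (fun t ht => ?_)
    (by rw [hV.init, hW.init, sub_self]) ht
  -- The forcing terms cancel, so the difference solves the homogeneous equation.
  rw [hV.deriv_eq ht (diff hVd t ht) (mV ⟨t, ht.le⟩), hW.deriv_eq ht (diff hWd t ht)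
    (mW ⟨t, ht.le⟩), add_sub_add_right_eq_sub, ← LinearPMap.map_sub]
  exact Beam.operator_inner_self _

end LaminatedBeam

end

theorem mainTheorem9 (P : LaminatedBeam.Beam) (u₁ u₂ u₃ : ℝ → ℝ)
    (hu₁ : LaminatedBeam.IsTestFunction (Set.Ioi 0) u₁) (hu₂ : LaminatedBeam.IsTestFunction (Set.Ioi 0) u₂)
    (hu₃ : LaminatedBeam.IsTestFunction (Set.Ioi 0) u₃)
    (U₀ : LaminatedBeam.State P) (hU₀ : U₀ ∈ P.operator.domain) :
    ∃ U : ℝ → LaminatedBeam.State P,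
      (LaminatedBeam.SolvesSystem P u₁ u₂ u₃ U₀ U ∧ LaminatedBeam.ContinuousInDomain P.operator U ∧
        ContDiffOn ℝ 1 U (Set.Ici 0)) ∧
      ∀ V : ℝ → LaminatedBeam.State P,
        (LaminatedBeam.SolvesSystem P u₁ u₂ u₃ U₀ V ∧ LaminatedBeam.ContinuousInDomain P.operator V ∧
          ContDiffOn ℝ 1 V (Set.Ici 0)) →
        Set.EqOn V U (Set.Ici 0) := by
  have hd : ∀ {u : ℝ → ℝ}, LaminatedBeam.IsTestFunction (Set.Ioi 0) u → ∀ t,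
      HasDerivAt u (deriv u t) t := fun hu t =>
    ((hu.contDiff.differentiable (by simp)) t).hasDerivAt
  have hF : Continuous (LaminatedBeam.forcing P u₁ u₂ u₃) := LaminatedBeam.continuous_forcing
    hu₁.contDiff.continuous hu₂.contDiff.continuous hu₃.contDiff.continuous
  -- The group yields a solution for all real times; it is restricted to `[0, ∞)` afterwards.
  obtain ⟨U, hAU, hU, h0⟩ := (P.isSkewGenerator_operator).exists_solution
    (fun t => LaminatedBeam.hasDerivAt_forcing (hd hu₁ t) (hd hu₂ t) (hd hu₃ t))
    (LaminatedBeam.continuous_forcing hu₁.deriv.contDiff.continuous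
      hu₂.deriv.contDiff.continuous hu₃.deriv.contDiff.continuous) ⟨U₀, hU₀⟩
  have hs := LaminatedBeam.solvesSystem_of_hasDerivAt hU (congrArg Subtype.val h0)
  have hc : LaminatedBeam.ContinuousInDomain P.operator fun t => (U t : LaminatedBeam.State P) :=
    ⟨fun t => (U t).2, (continuous_iff_continuousAt.2 fun t => (hU t).continuousAt).comp
      continuous_subtype_val, hAU.comp continuous_subtype_val⟩
  have hC : ContDiff ℝ 1 fun t => (U t : LaminatedBeam.State P) :=
    contDiff_one_iff_deriv.2 ⟨fun t => (hU t).differentiableAt, by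
      rw [(funext fun t => (hU t).deriv : deriv _ = _)]
      exact hAU.add hF⟩
  exact ⟨fun t => U t, ⟨hs, hc, hC.contDiffOn⟩, fun V ⟨h1, h2, h3⟩ =>
    h1.eqOn h2 h3 hs hc hC.contDiffOn⟩
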